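/- Let $d\ge 2$ and $\eta=\frac{d-1}{4}$; for $\vec p\in\mathbb Z^d$ write $\vec p^{\,2\eta}=\sum_{i=1}^d|p_i|^{2\eta}$ and, for a cutoff $\Lambda>0$ and a mass $m>0$, let $$C(\vec p\,)=\frac{\Theta(\Lambda^{2\eta}-\vec p^{\,2\eta})}{\vec p^{\,2\eta}+m^{2\eta}},\qquad \Theta(t)=1 \text{ for } t\ge 0,\ \Theta(t)=0\text{ for }t<0 .$$ A two-point tree $\mathcal T_n$ (in the intermediate field representation) is a tree with $n\ge 1$ loop vertices whose $n-1$ edges carry colors in $\{1,\dots,d\}$, together with one external colored edge hooked to a loop vertex $r$, the root. The coordination number $m(b)$ of a loop vertex $b$ is the number of colored edges hooked to $b$, the external edge included if $b=r$. For $p\in\mathbb Z$ the amplitude (couplings and symmetry factors stripped off) is $$\mathcal A_{\mathcal T_n}(p)=\sum_{(\vec p_b)_b}\ \prod_{b}C(\vec p_b)^{m(b)},$$ where the sum runs over all families of momenta $\vec p_b\in\mathbb Z^d$, one for each loop vertex, such that the components of color $c$ of $\vec p_u$ and $\vec p_v$ agree whenever $u,v$ are joined by an edge of color $c$, and such that the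 component of $\vec p_r$ in the color of the external edge is $p$. Put $\bar m^{2\eta}=m^{2\eta}/\Lambda^{2\eta}$, $x=|p|^{2\eta}/\Lambda^{2\eta}$, $\iota(d)=2^{d-1}\,\Gamma\!\left(\frac{d+1}{d-1}\right)^{d-1}$ and, for $\mu>0$, $$\omega(\mu)=\frac12\Big(\ln(1+\mu)+\mu-\mu^2\ln\frac{1+\mu}{\mu}\Big)=\int_0^\mu dt\int_0^1 dy\,\frac{y}{y+t}$$ (the equality of the two expressions is part of the claim). Define $$c_n(\mu,x)=(-1)^{n-1}\Big[\prod_{b\ne r}\frac{\omega^{(m(b))}(\mu)}{(m(b)-1)!}\Big]\mathcal A_r(x),\qquad \mathcal A_r(x)=\frac{1}{(m(r)-1)!}\frac{\partial^{m(r)-1}}{\partial\mu^{m(r)-1}}\Big[1-\frac{\mu+x}{1-x}\ln\frac{1+\mu}{\mu+x}\Big].$$ Then, if the $n$ colored edges of $\mathcal T_n$ (the external one included) have pairwise different colors, in the regime of large $\Lambda$ and large $d$ with $n$ and $\bar m^{2\eta}=\mu$ fixed, $$\mathcal A_{\mathcal T_n}(p)\sim(\Lambda^{2\eta}-|p|^{2\eta})\;c_n(\bar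 m^{2\eta},x)\;\iota(d)^n .$$ Precisely: for all $n\ge1$, $\mu>0$, $\delta>0$ and $\varepsilon>0$ there is a $D$ such that for every $d\ge D$ there is a $\Lambda_0>0$ such that for all $\Lambda\ge\Lambda_0$, with $m$ given by $(m/\Lambda)^{2\eta}=\mu$, for all such trees with pairwise different colors and all $p\in\mathbb Z$ with $|p|^{2\eta}\le(1-\delta)\Lambda^{2\eta}$, the difference of the two sides is at most $\varepsilon$ times the absolute value of the right-hand side. -/

import Mathlib

noncomputable section

namespace TGFT

/-- The exponent `η = (d - 1) / 4` of the Laplacian for which the rank-`d` model is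
just-renormalizable. -/
def eta (d : ℕ) : ℝ := ((d : ℝ) - 1) / 4

/-- `p^{2η} = ∑ i, |p i|^{2η}` for a momentum `p ∈ ℤ^d`. -/
def normPow {d : ℕ} (p : Fin d → ℤ) : ℝ := ∑ i, |(p i : ℝ)| ^ (2 * eta d)

/-- The propagator with sharp cutoff, `C(p) = Θ(Λ^{2η} - p^{2η}) / (p^{2η} + m^{2η})`. -/
def propagator {d : ℕ} (Λ m : ℝ) (p : Fin d → ℤ) : ℝ :=
  open Classical in
  if normPow p ≤ Λ ^ (2 * eta d) then 1 / (normPow p + m ^ (2 * eta d)) else 0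

/-- A two-point tree in the intermediate field representation: a tree on `n` loop vertices whose
edges carry colors in `{1, …, d}`, and one external (root) colored edge hooked to the loop vertex
`root`. The cyclic order of the half-edges around a loop vertex does not enter the amplitude and is
not recorded. -/
structure TwoPointTree (n d : ℕ) where
  graph : SimpleGraph (Fin n)
  isTree : graph.IsTree
  color : graph.edgeSet → Fin d
  root : Fin n
  rootColor : Fin d

namespace TwoPointTree

variable {n d : ℕ}

/-- All colored edges, the external one included, have pairwise different colors. -/
def DistinctColors (T : TwoPointTree n d) : Prop :=
  Function.Injective T.color ∧ ∀ e, T.color e ≠ T.rootColor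

/-- The coordination number `m(b)`: the number of colored edges hooked to the loop vertex `b`, the
external edge being counted at the root. It is also the number of corners (propagators) of `b`. -/
def coord (T : TwoPointTree n d) (b : Fin n) : ℕ :=
  open Classical in
  T.graph.degree b + if b = T.root then 1 else 0

/-- The constraint imposed by the faces on a family `P` of momenta, one in `ℤ^d` for each loop
vertex: across an edge of color `c` the components of color `c` agree, and the component that the
external face carries at the root is the external momentum `p`. -/
def FaceConstraint (T : TwoPointTree n d) (p : ℤ) (P : Fin n → Fin d → ℤ) : Prop :=
  P T.root T.rootColor = p ∧
    ∀ (u v : Fin n) (h : T.graph.Adj u v),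
      P u (T.color ⟨s(u, v), T.graph.mem_edgeSet.2 h⟩) =
        P v (T.color ⟨s(u, v), T.graph.mem_edgeSet.2 h⟩)

/-- The Feynman amplitude (without couplings and symmetry factor): the sum, over all momenta of the
loop vertices compatible with the faces, of the product of the propagators, one for each corner.
Only finitely many terms are nonzero, because of the cutoff. -/
def amplitude (T : TwoPointTree n d) (Λ m : ℝ) (p : ℤ) : ℝ :=
  open Classical in
  ∑' P : Fin n → Fin d → ℤ,
    if T.FaceConstraint p P then ∏ b, propagator Λ m (P b) ^ T.coord b else 0

end TwoPointTree

/-- `ι(d) = 2^{d-1} Γ((d+1)/(d-1))^{d-1}`, the explicit value of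
`2^{d-1} ∫_{x ≥ 0} δ(1 - x^{2η}) d^{d-1}x`. -/
def iota (d : ℕ) : ℝ := 2 ^ (d - 1) * Real.Gamma (((d : ℝ) + 1) / ((d : ℝ) - 1)) ^ (d - 1)

/-- `ω(μ)`, as a function of the variable `μ = m̄^{2η}`. -/
def omega (μ : ℝ) : ℝ :=
  (1 / 2) * (Real.log (1 + μ) + μ - μ ^ 2 * Real.log ((1 + μ) / μ))

/-- The root factor `A_r` for a root of coordination number `k`, at `μ = m̄^{2η}` and
`x = p^{2η} / Λ^{2η}`. -/
def rootFactor (k : ℕ) (μ x : ℝ) : ℝ :=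
  1 / ((k - 1).factorial : ℝ) *
    iteratedDeriv (k - 1)
      (fun t : ℝ => 1 - (t + x) / (1 - x) * Real.log ((1 + t) / (t + x))) μ

/-- The factor `c_n` of the tree `T`, at `μ = m̄^{2η}` and `x = p^{2η} / Λ^{2η}`. -/
def TwoPointTree.coeff {n d : ℕ} (T : TwoPointTree n d) (μ x : ℝ) : ℝ :=
  (-1) ^ (n - 1) *
    (∏ b ∈ Finset.univ.erase T.root,
      iteratedDeriv (T.coord b) omega μ / ((T.coord b - 1).factorial : ℝ)) *
    rootFactor (T.coord T.root) μ x

end TGFT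

end

noncomputable section

namespace TGFT

open Filter Topology MeasureTheory Set
open scoped Pointwise

/-! Write `s = 2η = (d - 1) / 2`. Pairwise different colors make the face constraint elementary:
each internal edge carries one free momentum, shared by its two ends, and the root carries `p`. Once
these edge momenta `Q` are fixed, the loop vertices are independent. So the amplitude is a sum over
`Q` of a product over vertices `b` of lattice sums in `d - m(b)` dimensions, in which `Q` enters
only through the offset `∑ (|Q i| / Λ) ^ s` over the colors at `b` (`amplitude_eq_sum`).

One vertex. A layer-cake formula writes the lattice sum in terms of numbers of lattice points in
`ℓˢ` balls. As `Λ → ∞` these become volumes, with radial exponent `(d - k) / s`, which tends to `2`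
as `d → ∞`. After division by powers of `2` and `ι(d)` the ball volume tends to `1 / Γ(3) = 1 / 2`,
and an integration by parts gives the limit `∫ u in x..1, (u - x) / (u + μ) ^ k`
(`tendsto_normShellSum`). Both the sums and the limit are controlled uniformly in the offset, since
the sums are monotone in it and the limit is continuous (`eventually_normShellSum_bounds`).

The edges. For large `s`, `(|q| / Λ) ^ s` is negligible for nearly all `|q| ≤ Λ`: it is at most `σ`
when `|q| ≤ σ ^ (1 / s) * Λ`, and `σ ^ (1 / s) → 1`. Hence the sum over `Q` is asymptotically `(2Λ)
^ (n - 1)` times the product with zero edge momenta. Monotonicity gives the upper bound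
(`Regime.sum_le`), restriction to the smaller box the lower one (`Regime.le_sum`).

The coefficient. `ω'` is the loop integral with `k = 1`, `x = 0`, and differentiating in `μ` raises
`k`, so `c_n` is, up to the factor `1 - x`, the product of the limiting loop integrals (`coeff_eq`).
-/

/-- The power sum of a lattice point, in units of the cutoff. -/
def powSum {I : Type*} [Fintype I] (s Λ : ℝ) (w : I → ℤ) : ℝ := ∑ i, (|(w i : ℝ)| / Λ) ^ s

/-- The `k`-th power of the propagator, in units of the cutoff. -/
def cut (k : ℕ) (μ t : ℝ) : ℝ := if t ≤ 1 then ((t + μ) ^ k)⁻¹ else 0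

/-- The sum of `cut` over a lattice, with offset `x`. -/
def shellSum (I : Type*) [Fintype I] (s : ℝ) (k : ℕ) (Λ μ x : ℝ) : ℝ :=
  ∑' w : I → ℤ, cut k μ (x + powSum s Λ w)

/-- The number of lattice points with power sum at most `t`. -/
def latticeCount (I : Type*) [Fintype I] (s Λ t : ℝ) : ℝ :=
  (Nat.card {w : I → ℤ | powSum s Λ w ≤ t} : ℝ)

/-! ### Lattice points in `ℓˢ` balls -/

section Lattice

variable {I : Type*} [Fintype I]

lemma powSum_nonneg {s Λ : ℝ} (hΛ : 0 < Λ) (w : I → ℤ) : 0 ≤ powSum s Λ w :=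
  Finset.sum_nonneg fun i _ => by positivity

lemma abs_le_of_powSum_le {s Λ t : ℝ} (hs : 0 < s) (hΛ : 0 < Λ) {w : I → ℤ}
    (h : powSum s Λ w ≤ t) (i : I) : |(w i : ℝ)| ≤ t ^ (1 / s) * Λ := by
  have h1 : (|(w i : ℝ)| / Λ) ^ s ≤ t :=
    (Finset.single_le_sum (f := fun i => (|(w i : ℝ)| / Λ) ^ s)
      (fun i _ => by positivity) (Finset.mem_univ i)).trans h
  have h2 : |(w i : ℝ)| / Λ ≤ t ^ (1 / s) := by
    calc |(w i : ℝ)| / Λ = ((|(w i : ℝ)| / Λ) ^ s) ^ (1 / s) := by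
          rw [← Real.rpow_mul (by positivity), mul_one_div_cancel hs.ne', Real.rpow_one]
      _ ≤ _ := Real.rpow_le_rpow (by positivity) h1 (by positivity)
  rwa [div_le_iff₀ hΛ] at h2

lemma finite_powSum_le {s Λ : ℝ} (hs : 0 < s) (hΛ : 0 < Λ) (t : ℝ) :
    {w : I → ℤ | powSum s Λ w ≤ t}.Finite := by
  classical
  refine (Set.finite_Icc (fun _ : I => -⌈t ^ (1 / s) * Λ⌉) (fun _ => ⌈t ^ (1 / s) * Λ⌉)).subset ?_
  intro w hw
  have h (i : I) : |w i| ≤ ⌈t ^ (1 / s) * Λ⌉ := by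
    have := (abs_le_of_powSum_le hs hΛ hw i).trans (Int.le_ceil _)
    exact_mod_cast this
  exact ⟨fun i => (abs_le.1 (h i)).1, fun i => (abs_le.1 (h i)).2⟩

lemma latticeCount_mono {s Λ : ℝ} (hs : 0 < s) (hΛ : 0 < Λ) : Monotone (latticeCount I s Λ) := by
  intro a b hab
  unfold latticeCount
  exact_mod_cast Nat.card_mono (finite_powSum_le hs hΛ b) fun w hw => le_trans hw hab

lemma latticeCount_nonneg (s Λ t : ℝ) : 0 ≤ latticeCount I s Λ t := Nat.cast_nonneg _

lemma convex_sum_rpow_le {s : ℝ} (hs : 1 ≤ s) (t : ℝ) :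
    Convex ℝ {x : I → ℝ | ∑ i, |x i| ^ s ≤ t} := by
  have h : ConvexOn ℝ univ fun x : I → ℝ => ∑ i, |x i| ^ s := by
    refine ⟨convex_univ, fun x _ y _ a b ha hb hab => ?_⟩
    simp only [smul_eq_mul, Finset.mul_sum, ← Finset.sum_add_distrib]
    refine Finset.sum_le_sum fun i _ => ?_
    have h1 : |(a • x + b • y) i| ≤ a * |x i| + b * |y i| := by
      refine (abs_add_le _ _).trans (le_of_eq ?_)
      simp [abs_mul, abs_of_nonneg ha, abs_of_nonneg hb]
    refine (Real.rpow_le_rpow (abs_nonneg _) h1 (by linarith)).trans ?_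
    exact (convexOn_rpow hs).2 (abs_nonneg (x i)) (abs_nonneg (y i)) ha hb hab
  simpa using h.convex_le t

/-- Moves the dilation from the ball to the lattice: a fixed convex set meets `Λ⁻¹ ℤ^I`, the setting
in which point counts are compared with volume. -/
lemma latticeCount_eq {s Λ t : ℝ} (hΛ : 0 < Λ) : latticeCount I s Λ t =
    Nat.card ↑({x : I → ℝ | ∑ i, |x i| ^ s ≤ t} ∩
      (Λ⁻¹ • (Submodule.span ℤ (Set.range (Pi.basisFun ℝ I))) : Submodule ℤ (I → ℝ))) := by
  have hinj : Function.Injective fun (w : I → ℤ) (i : I) => (w i : ℝ) / Λ := by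
    intro w v h
    funext i
    have := congrFun h i
    simp only at this
    rw [div_left_inj' hΛ.ne'] at this
    exact_mod_cast this
  unfold latticeCount
  rw [← Nat.card_image_of_injective hinj]
  congr 3
  ext v
  have hmem : v ∈ ((Λ⁻¹ • (Submodule.span ℤ (Set.range (Pi.basisFun ℝ I))) :
      Submodule ℤ (I → ℝ)) : Set (I → ℝ)) ↔ ∃ w : I → ℤ, (fun i => (w i : ℝ) / Λ) = v := by
    rw [SetLike.mem_coe, ZSpan.smul _ (inv_ne_zero hΛ.ne'), Module.Basis.mem_span_iff_repr_mem]
    simp_rw [Module.Basis.repr_isUnitSMul, Pi.basisFun_repr, Units.smul_def,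
      Units.val_inv_eq_inv_val, IsUnit.unit_spec, inv_inv, smul_eq_mul]
    constructor
    · intro h
      choose w hw using h
      refine ⟨w, funext fun i => ?_⟩
      rw [div_eq_iff hΛ.ne']
      simpa [mul_comm] using hw i
    · rintro ⟨w, rfl⟩ i
      exact ⟨w i, by simp [mul_div_cancel₀ _ hΛ.ne']⟩
  rw [Set.mem_inter_iff, hmem]
  constructor
  · rintro ⟨w, hw, rfl⟩
    refine ⟨?_, w, rfl⟩
    simpa [powSum, abs_div, abs_of_pos hΛ] using hw
  · rintro ⟨hv, w, rfl⟩
    exact ⟨w, by simpa [powSum, abs_div, abs_of_pos hΛ] using hv, rfl⟩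

lemma tendsto_latticeCount [Nonempty I] {s t : ℝ} (hs : 1 ≤ s) (ht : 0 ≤ t) :
    Tendsto (fun Λ : ℝ => latticeCount I s Λ t / Λ ^ Fintype.card I) atTop
      (𝓝 (t ^ (Fintype.card I / s) * ((2 * Real.Gamma (1 / s + 1)) ^ Fintype.card I /
        Real.Gamma (Fintype.card I / s + 1)))) := by
  have hs0 : 0 < s := by linarith
  set S := {x : I → ℝ | ∑ i, |x i| ^ s ≤ t} with hS
  have hconv : Convex ℝ S := convex_sum_rpow_le hs t
  have hclosed : IsClosed S := by
    refine isClosed_le ?_ continuous_const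
    refine continuous_finsetSum _ fun i _ => ?_
    exact ((continuous_apply i).abs).rpow_const fun _ => Or.inr hs0.le
  have hbdd : Bornology.IsBounded S := by
    refine (Metric.isBounded_closedBall (x := (0 : I → ℝ)) (r := t ^ (1 / s))).subset ?_
    intro x hx
    rw [mem_closedBall_zero_iff, pi_norm_le_iff_of_nonneg (by positivity)]
    intro i
    have h1 : |x i| ^ s ≤ t :=
      (Finset.single_le_sum (f := fun i => |x i| ^ s)
        (fun i _ => by positivity) (Finset.mem_univ i)).trans hx
    calc |x i| = (|x i| ^ s) ^ (1 / s) := by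
          rw [← Real.rpow_mul (by positivity), mul_one_div_cancel hs0.ne', Real.rpow_one]
      _ ≤ _ := Real.rpow_le_rpow (by positivity) h1 (by positivity)
  have h0 : (0 : I → ℝ) ∈ S := by simp [hS, Real.zero_rpow hs0.ne', ht]
  -- Dilates of a convex set containing `0` increase; this allows real, not only integer, scales in
  -- the limit.
  have hscale : ∀ ⦃x y : ℝ⦄, 0 < x → x ≤ y → x • S ⊆ y • S := by
    rintro x y hx hxy _ ⟨z, hz, rfl⟩
    have hy : 0 < y := hx.trans_le hxy
    refine ⟨(x / y) • z, hconv.smul_mem_of_zero_mem h0 hz ⟨by positivity, ?_⟩, ?_⟩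
    · rwa [div_le_one hy]
    · simp only [smul_smul]
      rw [mul_div_cancel₀ _ hy.ne']
  have hvol : volume.real S = t ^ (Fintype.card I / s) *
      ((2 * Real.Gamma (1 / s + 1)) ^ Fintype.card I / Real.Gamma (Fintype.card I / s + 1)) := by
    have hSeq : S = {x : I → ℝ | (∑ i, |x i| ^ s) ^ (1 / s) ≤ t ^ (1 / s)} := by
      ext x
      have hx : 0 ≤ ∑ i, |x i| ^ s := Finset.sum_nonneg fun i _ => by positivity
      simp only [hS, mem_ofPred_eq]
      rw [Real.rpow_le_rpow_iff hx ht (by positivity)]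
    have hG1 : 0 < Real.Gamma (1 / s + 1) := Real.Gamma_pos_of_pos (by positivity)
    have hG2 : 0 < Real.Gamma (Fintype.card I / s + 1) := Real.Gamma_pos_of_pos (by positivity)
    rw [Measure.real, hSeq, volume_sum_rpow_le I hs, ENNReal.toReal_mul, ENNReal.toReal_pow,
      ENNReal.toReal_ofReal (by positivity), ENNReal.toReal_ofReal (by positivity),
      ← Real.rpow_natCast, ← Real.rpow_mul ht]
    congr 2
    ring
  have := tendsto_card_div_pow_atTop_volume' S hbdd hclosed.measurableSet
    (hconv.addHaar_frontier _) hscale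
  rw [hvol] at this
  refine this.congr' ?_
  filter_upwards [eventually_gt_atTop 0] with Λ hΛ
  rw [latticeCount_eq hΛ, Submodule.coe_pointwise_smul]

end Lattice


/-! ### Lattice sums of the propagator as `Λ → ∞` -/

section Shell

variable {I : Type*} [Fintype I] {k : ℕ} {s Λ μ x : ℝ}

lemma cut_nonneg {t : ℝ} (ht : 0 ≤ t + μ) : 0 ≤ cut k μ t := by
  unfold cut
  split_ifs <;> positivity

lemma cut_anti {t u : ℝ} (ht : 0 < t + μ) (htu : t ≤ u) : cut k μ u ≤ cut k μ t := by
  unfold cut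
  split_ifs with h1 h2
  · gcongr
  · exact absurd (htu.trans h1) h2
  · positivity
  · exact le_rfl

lemma cut_eq_zero {t : ℝ} (ht : 1 < t) : cut k μ t = 0 := if_neg ht.not_ge

lemma support_cut_subset : Function.support (fun w : I → ℤ => cut k μ (x + powSum s Λ w)) ⊆
    {w | powSum s Λ w ≤ 1 - x} := by
  intro w hw
  by_contra h
  refine hw (cut_eq_zero ?_)
  simp only [mem_ofPred_eq, not_le] at h
  linarith

lemma summable_cut (hs : 0 < s) (hΛ : 0 < Λ) :
    Summable fun w : I → ℤ => cut k μ (x + powSum s Λ w) :=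
  summable_of_hasFiniteSupport ((finite_powSum_le hs hΛ (1 - x)).subset support_cut_subset)

lemma shellSum_nonneg (hΛ : 0 < Λ) (hx : 0 ≤ x + μ) : 0 ≤ shellSum I s k Λ μ x :=
  tsum_nonneg fun w => cut_nonneg (by linarith [powSum_nonneg (s := s) hΛ w])

lemma shellSum_anti {y : ℝ} (hs : 0 < s) (hΛ : 0 < Λ) (hx : 0 < x + μ) (hxy : x ≤ y) :
    shellSum I s k Λ μ y ≤ shellSum I s k Λ μ x :=
  Summable.tsum_le_tsum (fun w => cut_anti (by linarith [powSum_nonneg (s := s) hΛ w])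
    (by linarith)) (summable_cut hs hΛ) (summable_cut hs hΛ)

lemma shellSum_congr {J : Type*} [Fintype J] (e : I ≃ J) :
    shellSum I s k Λ μ x = shellSum J s k Λ μ x := by
  unfold shellSum
  rw [← (e.arrowCongr (Equiv.refl ℤ)).tsum_eq]
  refine tsum_congr fun w => ?_
  congr 2
  unfold powSum
  exact Fintype.sum_equiv e _ _ (by simp)

/-- Minus the derivative of `t ↦ (t + μ)⁻ᵏ`. -/
def slope (k : ℕ) (μ u : ℝ) : ℝ := k / (u + μ) ^ (k + 1)

lemma slope_nonneg {u : ℝ} (hu : 0 ≤ u + μ) : 0 ≤ slope k μ u := by unfold slope; positivity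

lemma continuousOn_slope {a b : ℝ} (ha : 0 < a + μ) : ContinuousOn (slope k μ) (Icc a b) := by
  unfold slope
  refine continuousOn_const.div (by fun_prop) fun u hu => ?_
  have : 0 < u + μ := by linarith [hu.1]
  positivity

lemma hasDerivAt_inv_pow {u : ℝ} (hu : 0 < u + μ) :
    HasDerivAt (fun t => ((t + μ) ^ k)⁻¹) (-slope k μ u) u := by
  have h := (((hasDerivAt_id u).add_const μ).fun_pow k).fun_inv (by simp only [id]; positivity)
  convert! h using 1
  simp only [slope, id]
  rcases k with _ | k
  · simp
  · field_simp
    simp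
    ring

lemma integral_slope {a b : ℝ} (ha : 0 < a + μ) (hab : a ≤ b) :
    ∫ u in a..b, slope k μ u = ((a + μ) ^ k)⁻¹ - ((b + μ) ^ k)⁻¹ := by
  have h := intervalIntegral.integral_eq_sub_of_hasDerivAt (a := a) (b := b)
    (f := fun t => -((t + μ) ^ k)⁻¹) (f' := slope k μ)
    (fun u hu => by
      rw [uIcc_of_le hab] at hu
      simpa using (hasDerivAt_inv_pow (k := k) (by linarith [hu.1] : 0 < u + μ)).fun_neg)
    ((continuousOn_slope ha).intervalIntegrable_of_Icc hab)
  rw [h]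
  ring

/-- Layer-cake form of the cut-off power. The constant `((1 + μ) ^ k)⁻¹` is the jump of the sharp
cutoff at `1`. -/
lemma cut_eq_integral {r : ℝ} (hx : 0 < x + μ) (hr : 0 ≤ r) (hrx : x + r ≤ 1) :
    cut k μ (x + r) = ((1 + μ) ^ k)⁻¹ + ∫ u in x..1, if r ≤ u - x then slope k μ u else 0 := by
  have hI : IntervalIntegrable (slope k μ) volume (x + r) 1 :=
    (continuousOn_slope (by linarith)).intervalIntegrable_of_Icc hrx
  have e1 : EqOn (fun u => if r ≤ u - x then slope k μ u else 0) (slope k μ) (Ioo (x + r) 1) :=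
    fun u hu => if_pos (by linarith [hu.1])
  have e2 : EqOn (fun u => if r ≤ u - x then slope k μ u else 0) (fun _ => 0) (Ioo x (x + r)) :=
    fun u hu => if_neg (by linarith [hu.2])
  have i1 : IntervalIntegrable (fun u => if r ≤ u - x then slope k μ u else 0) volume
      (x + r) 1 := hI.congr_uIoo (by rw [uIoo_of_le hrx]; exact e1.symm)
  have i2 : IntervalIntegrable (fun u => if r ≤ u - x then slope k μ u else 0) volume
      x (x + r) :=
    (intervalIntegrable_const (c := (0 : ℝ))).congr_uIoo
      (by rw [uIoo_of_le (by linarith)]; exact e2.symm)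
  rw [← intervalIntegral.integral_add_adjacent_intervals i2 i1,
    intervalIntegral.integral_congr_Ioo_of_le hrx e1,
    intervalIntegral.integral_congr_Ioo_of_le (by linarith) e2, integral_slope (by linarith) hrx,
    cut, if_pos hrx]
  simp

lemma intervalIntegrable_ite_slope {r : ℝ} (hx : 0 < x + μ) (hx1 : x ≤ 1) :
    IntervalIntegrable (fun u => if r ≤ u - x then slope k μ u else 0) volume x 1 := by
  have h := ((continuousOn_slope (k := k) (b := 1) hx).intervalIntegrable_of_Icc hx1
    (μ := volume))
  rw [intervalIntegrable_iff] at h ⊢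
  have : (fun u => if r ≤ u - x then slope k μ u else 0) =
      {u | r ≤ u - x}.indicator (slope k μ) := by
    ext u; simp [indicator]
  rw [this]
  exact h.indicator (measurableSet_le measurable_const (by fun_prop))

/-- Sums the layer-cake formula over the finitely many points below the cutoff and exchanges sum and
integral. -/
lemma shellSum_eq_latticeCount (hs : 0 < s) (hΛ : 0 < Λ) (hx : 0 < x + μ) (hx1 : x ≤ 1) :
    shellSum I s k Λ μ x = latticeCount I s Λ (1 - x) * ((1 + μ) ^ k)⁻¹ +
      ∫ u in x..1, latticeCount I s Λ (u - x) * slope k μ u := by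
  classical
  have hfin := finite_powSum_le (I := I) hs hΛ (1 - x)
  set F := hfin.toFinset with hF
  have hmem (w : I → ℤ) : w ∈ F ↔ powSum s Λ w ≤ 1 - x := by simp [hF]
  have hcount : ∀ t ≤ 1 - x, latticeCount I s Λ t = ∑ w ∈ F, if powSum s Λ w ≤ t then 1 else 0 := by
    intro t ht
    rw [latticeCount, Finset.sum_boole, Nat.card_coe_set_eq,
      Set.ncard_eq_toFinset_card _ (finite_powSum_le hs hΛ t)]
    · congr 2
      ext w
      simp only [Finite.mem_toFinset, mem_ofPred_eq, Finset.mem_filter, hmem]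
      exact ⟨fun h => ⟨h.trans ht, h⟩, fun h => h.2⟩
  have h1 : shellSum I s k Λ μ x = ∑ w ∈ F, cut k μ (x + powSum s Λ w) := by
    refine tsum_eq_sum fun w hw => cut_eq_zero ?_
    rw [hmem, not_le] at hw
    linarith
  have h2 : ∫ u in x..1, latticeCount I s Λ (u - x) * slope k μ u =
      ∫ u in x..1, ∑ w ∈ F, if powSum s Λ w ≤ u - x then slope k μ u else 0 := by
    refine intervalIntegral.integral_congr fun u hu => ?_
    rw [uIcc_of_le hx1] at hu
    rw [hcount _ (by linarith [hu.2]), Finset.sum_mul]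
    exact Finset.sum_congr rfl fun w _ => by split_ifs <;> simp
  rw [h1, h2, hcount _ le_rfl,
    intervalIntegral.integral_finsetSum fun w _ => intervalIntegrable_ite_slope hx hx1,
    Finset.sum_mul, ← Finset.sum_add_distrib]
  refine Finset.sum_congr rfl fun w hw => ?_
  rw [hmem] at hw
  rw [if_pos hw, one_mul, cut_eq_integral hx (powSum_nonneg hΛ w) (by linarith)]

/-- The volume of the unit ball of the `ℓˢ` norm in `ℝᴺ`. -/
def ballVol (N : ℕ) (s : ℝ) : ℝ :=
  (2 * Real.Gamma (1 / s + 1)) ^ N / Real.Gamma (N / s + 1)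

lemma tendsto_shellSum_cutoff [Nonempty I] (hs : 1 ≤ s) (hx : 0 < x + μ) (hx1 : x ≤ 1) :
    Tendsto (fun Λ : ℝ => shellSum I s k Λ μ x / Λ ^ Fintype.card I) atTop
      (𝓝 ((1 - x) ^ (Fintype.card I / s) * ballVol (Fintype.card I) s * ((1 + μ) ^ k)⁻¹ +
        ∫ u in x..1, (u - x) ^ (Fintype.card I / s) * ballVol (Fintype.card I) s *
          slope k μ u)) := by
  have hs0 : 0 < s := by linarith
  have hlim (t : ℝ) (ht : 0 ≤ t) := tendsto_latticeCount (I := I) hs ht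
  have hmain : Tendsto (fun Λ : ℝ => ∫ u in x..1,
      latticeCount I s Λ (u - x) / Λ ^ Fintype.card I * slope k μ u) atTop
      (𝓝 (∫ u in x..1, (u - x) ^ (Fintype.card I / s) * ballVol (Fintype.card I) s *
          slope k μ u)) := by
    -- The count is monotone in the radius, so its limit at the largest radius `1 - x`, plus one,
    -- dominates for large `Λ`.
    set B := (1 - x) ^ (Fintype.card I / s) * ballVol (Fintype.card I) s + 1 with hB
    refine intervalIntegral.tendsto_integral_filter_of_dominated_convergence
      (fun u => B * slope k μ u) ?_ ?_ ?_ ?_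
    · filter_upwards [eventually_gt_atTop 0] with Λ hΛ
      refine AEStronglyMeasurable.mul ?_ ?_
      · refine Measurable.aestronglyMeasurable ?_
        exact ((latticeCount_mono hs0 hΛ).measurable.comp (measurable_id.sub_const x)).div_const _
      · rw [uIoc_of_le hx1]
        exact ((continuousOn_slope hx).mono Ioc_subset_Icc_self).aestronglyMeasurable
          measurableSet_Ioc
    · have hev := (hlim (1 - x) (by linarith)).eventually (gt_mem_nhds (lt_add_one _))
      filter_upwards [eventually_gt_atTop 0, hev] with Λ hΛ hb
      refine Eventually.of_forall fun u hu => ?_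
      rw [uIoc_of_le hx1] at hu
      have hsl : 0 ≤ slope k μ u := slope_nonneg (by linarith [hu.1])
      have h0 := latticeCount_nonneg (I := I) s Λ (u - x)
      rw [Real.norm_of_nonneg (by positivity)]
      refine mul_le_mul_of_nonneg_right (le_trans ?_ hb.le) hsl
      gcongr
      exact latticeCount_mono hs0 hΛ (by linarith [hu.2])
    · exact ((continuousOn_const.mul (continuousOn_slope hx)).intervalIntegrable_of_Icc hx1)
    · refine Eventually.of_forall fun u hu => ?_
      rw [uIoc_of_le hx1] at hu
      exact (hlim (u - x) (by linarith [hu.1])).mul_const _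
  refine (((hlim (1 - x) (by linarith)).mul_const (((1 + μ) ^ k)⁻¹)).add hmain).congr' ?_
  filter_upwards [eventually_gt_atTop 0] with Λ hΛ
  rw [shellSum_eq_latticeCount hs0 hΛ hx hx1, add_div]
  congr 1
  · ring
  · rw [← intervalIntegral.integral_div]
    exact intervalIntegral.integral_congr fun u _ => by ring

end Shell

/-! ### The loop integral as the limit of large dimension -/

/-- The integral that replaces a loop vertex in the limit. -/
def loopIntegral (μ : ℝ) (k : ℕ) (x : ℝ) : ℝ := ∫ u in x..1, (u - x) / (u + μ) ^ k

/-- Integration by parts undoes the layer-cake formula: the boundary term at `1` is the jump of the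
cutoff, the one at `x` vanishes. -/
lemma loopIntegral_eq {μ x : ℝ} (k : ℕ) (hx : 0 < x + μ) (hx1 : x ≤ 1) :
    (1 - x) ^ 2 / 2 * ((1 + μ) ^ k)⁻¹ + ∫ u in x..1, (u - x) ^ 2 / 2 * slope k μ u =
      loopIntegral μ k x := by
  have h := intervalIntegral.integral_mul_deriv_eq_deriv_mul (a := x) (b := 1)
    (u := fun u => ((u + μ) ^ k)⁻¹) (u' := fun u => -slope k μ u)
    (v := fun u => (u - x) ^ 2 / 2) (v' := fun u => u - x)
    (fun u hu => by
      rw [uIcc_of_le hx1] at hu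
      exact hasDerivAt_inv_pow (by linarith [hu.1]))
    (fun u _ => by
      have := (((hasDerivAt_id u).sub_const x).fun_pow 2).div_const 2
      convert! this using 1
      simp)
    ((continuousOn_slope hx).neg.intervalIntegrable_of_Icc hx1)
    (by apply Continuous.intervalIntegrable; fun_prop)
  have e : loopIntegral μ k x = ∫ u in x..1, ((u + μ) ^ k)⁻¹ * (u - x) :=
    intervalIntegral.integral_congr fun u _ => by rw [div_eq_inv_mul]
  rw [e, h]
  simp only [sub_self, neg_mul, intervalIntegral.integral_neg]
  have : ∫ u in x..1, slope k μ u * ((u - x) ^ 2 / 2) =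
      ∫ u in x..1, (u - x) ^ 2 / 2 * slope k μ u :=
    intervalIntegral.integral_congr fun u _ => by ring
  rw [this]
  ring


/-- `shellSum` in `d - k` dimensions, divided by its order of magnitude. -/
def normShellSum (k : ℕ) (μ : ℝ) (d : ℕ) (Λ x : ℝ) : ℝ :=
  2 ^ (k - 1) / iota d * (shellSum (Fin (d - k)) (2 * eta d) k Λ μ x / Λ ^ (d - k))

lemma two_mul_eta (d : ℕ) : 2 * eta d = ((d : ℝ) - 1) / 2 := by unfold eta; ring

lemma tendsto_two_mul_eta : Tendsto (fun d : ℕ => 2 * eta d) atTop atTop := by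
  simp_rw [two_mul_eta]
  exact (tendsto_atTop_add_const_right _ _ tendsto_natCast_atTop_atTop).atTop_div_const two_pos

lemma tendsto_one_div_two_mul_eta : Tendsto (fun d : ℕ => 1 / (2 * eta d)) atTop (𝓝 0) := by
  simp_rw [one_div]
  exact tendsto_two_mul_eta.inv_tendsto_atTop

/-- The quotient is `2 + (1 - k) / (2η)`; the choice of `η` makes the limit independent of `k`. -/
lemma tendsto_dim_div (k : ℕ) :
    Tendsto (fun d : ℕ => ((d - k : ℕ) : ℝ) / (2 * eta d)) atTop (𝓝 2) := by
  have h := (tendsto_one_div_two_mul_eta.const_mul ((1 : ℝ) - k)).const_add 2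
  rw [mul_zero, add_zero] at h
  refine h.congr' ?_
  filter_upwards [eventually_ge_atTop k, eventually_ge_atTop 2] with d hk hd
  have hd' : (2 : ℝ) ≤ d := by exact_mod_cast hd
  have : (d : ℝ) - 1 ≠ 0 := by linarith
  rw [Nat.cast_sub hk, two_mul_eta]
  field_simp
  ring

lemma iota_eq {d : ℕ} (hd : 2 ≤ d) :
    iota d = (2 * Real.Gamma (1 / (2 * eta d) + 1)) ^ (d - 1) := by
  have hd' : (2 : ℝ) ≤ d := by exact_mod_cast hd
  have h1 : (d : ℝ) - 1 ≠ 0 := by linarith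
  have : ((d : ℝ) + 1) / (d - 1) = 1 / (2 * eta d) + 1 := by
    rw [two_mul_eta]; field_simp; ring
  rw [iota, this, mul_pow]

lemma two_mul_eta_pos {d : ℕ} (hd : 2 ≤ d) : 0 < 2 * eta d := by
  have hd' : (2 : ℝ) ≤ d := by exact_mod_cast hd
  rw [two_mul_eta]
  linarith

lemma iota_pos {d : ℕ} (hd : 2 ≤ d) : 0 < iota d := by
  have := two_mul_eta_pos hd
  rw [iota_eq hd]
  have : 0 < Real.Gamma (1 / (2 * eta d) + 1) := Real.Gamma_pos_of_pos (by positivity)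
  positivity

lemma continuousAt_Gamma {t : ℝ} (ht : 0 < t) : ContinuousAt Real.Gamma t :=
  (Real.differentiableAt_Gamma fun m => by
    have : (0 : ℝ) ≤ m := m.cast_nonneg
    linarith).continuousAt

/-- `ι(d)` contains `d - 1` factors `2Γ(1 / s + 1)` and the ball volume `d - k` of them. The `k - 1`
left over tend to `2` each and cancel `2 ^ (k - 1)`; what remains is `1 / Γ(3)`. -/
lemma tendsto_ballVol {k : ℕ} (hk : 1 ≤ k) :
    Tendsto (fun d : ℕ => 2 ^ (k - 1) / iota d * ballVol (d - k) (2 * eta d)) atTop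
      (𝓝 (1 / 2)) := by
  have hG1 : Tendsto (fun d : ℕ => Real.Gamma (1 / (2 * eta d) + 1)) atTop (𝓝 1) := by
    have hc : ContinuousAt Real.Gamma 1 := continuousAt_Gamma one_pos
    have h := hc.tendsto
    rw [Real.Gamma_one] at h
    exact h.comp (by simpa using tendsto_one_div_two_mul_eta.add_const 1)
  have hG2 : Tendsto (fun d : ℕ => Real.Gamma (((d - k : ℕ) : ℝ) / (2 * eta d) + 1)) atTop
      (𝓝 2) := by
    have hc : ContinuousAt Real.Gamma (2 + 1) := continuousAt_Gamma (by norm_num)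
    have h := hc.tendsto
    rw [Real.Gamma_add_one two_ne_zero, Real.Gamma_two, mul_one] at h
    exact h.comp ((tendsto_dim_div k).add_const 1)
  have h := (hG1.pow (k - 1)).inv₀ (by simp) |>.div hG2 two_ne_zero
  simp only [one_pow, inv_one] at h
  refine h.congr' ?_
  filter_upwards [eventually_ge_atTop k, eventually_ge_atTop 2] with d hkd hd
  have hs := two_mul_eta_pos hd
  have hpos : 0 < Real.Gamma (1 / (2 * eta d) + 1) := Real.Gamma_pos_of_pos (by positivity)
  have hsplit : d - 1 = (k - 1) + (d - k) := by omega
  simp only [Pi.div_apply]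
  rw [iota_eq hd, ballVol, hsplit, pow_add, mul_pow]
  generalize Real.Gamma (1 / (2 * eta d) + 1) = G at hpos
  generalize Real.Gamma (((d - k : ℕ) : ℝ) / (2 * eta d) + 1) = K
  field_simp

lemma tendsto_normShellSum_inner {k d : ℕ} {μ x : ℝ} (hkd : k < d) (hd : 3 ≤ d)
    (hx : 0 < x + μ) (hx1 : x ≤ 1) :
    Tendsto (fun Λ : ℝ => normShellSum k μ d Λ x) atTop
      (𝓝 ((1 - x) ^ (((d - k : ℕ) : ℝ) / (2 * eta d)) *
          (2 ^ (k - 1) / iota d * ballVol (d - k) (2 * eta d)) * ((1 + μ) ^ k)⁻¹ +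
        ∫ u in x..1, (u - x) ^ (((d - k : ℕ) : ℝ) / (2 * eta d)) *
          (2 ^ (k - 1) / iota d * ballVol (d - k) (2 * eta d)) * slope k μ u)) := by
  have hd' : (3 : ℝ) ≤ d := by exact_mod_cast hd
  have : Nonempty (Fin (d - k)) := ⟨⟨0, by omega⟩⟩
  have h := (tendsto_shellSum_cutoff (I := Fin (d - k)) (k := k) (s := 2 * eta d)
    (by rw [two_mul_eta]; linarith) hx hx1).const_mul (2 ^ (k - 1) / iota d)
  simp only [Fintype.card_fin] at h
  unfold normShellSum
  convert! h using 2
  rw [mul_add, ← intervalIntegral.integral_const_mul]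
  congr 1
  · ring
  · exact intervalIntegral.integral_congr fun u _ => by ring

/-- The filter `atTop.curry atTop` encodes the iterated limit: `Λ → ∞` at fixed `d`, then `d → ∞`.
No joint uniformity is claimed. -/
theorem tendsto_normShellSum {k : ℕ} {μ x : ℝ} (hk : 1 ≤ k) (hμ : 0 < μ) (hx : 0 ≤ x)
    (hx1 : x < 1) :
    Tendsto (fun z : ℕ × ℝ => normShellSum k μ z.1 z.2 x) (atTop.curry atTop)
      (𝓝 (loopIntegral μ k x)) := by
  set β : ℕ → ℝ := fun d => ((d - k : ℕ) : ℝ) / (2 * eta d) with hβ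
  set V : ℕ → ℝ := fun d => 2 ^ (k - 1) / iota d * ballVol (d - k) (2 * eta d) with hV
  have hβlim : Tendsto β atTop (𝓝 2) := tendsto_dim_div k
  have hVlim : Tendsto V atTop (𝓝 (1 / 2)) := tendsto_ballVol hk
  have hpow (r : ℝ) (hr : 0 < r) : Tendsto (fun d => r ^ β d) atTop (𝓝 (r ^ 2)) := by
    rw [← Real.rpow_two]
    exact (Real.continuousAt_const_rpow hr.ne').tendsto.comp hβlim
  have houter : Tendsto (fun d : ℕ => (1 - x) ^ β d * V d * ((1 + μ) ^ k)⁻¹ +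
      ∫ u in x..1, (u - x) ^ β d * V d * slope k μ u) atTop (𝓝 (loopIntegral μ k x)) := by
    rw [← loopIntegral_eq k (by linarith) hx1.le]
    refine Tendsto.add ?_ ?_
    · have := ((hpow (1 - x) (by linarith)).mul hVlim).mul_const (((1 + μ) ^ k)⁻¹)
      rwa [mul_one_div] at this
    · refine intervalIntegral.tendsto_integral_filter_of_dominated_convergence
        (fun u => 1 * slope k μ u) ?_ ?_ ?_ ?_
      · filter_upwards [hβlim.eventually (lt_mem_nhds two_pos)] with d hd
        rw [uIoc_of_le hx1.le]
        refine ContinuousOn.aestronglyMeasurable ?_ measurableSet_Ioc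
        refine ContinuousOn.mul (ContinuousOn.mul (Continuous.continuousOn ?_) continuousOn_const)
          ((continuousOn_slope (by linarith)).mono Ioc_subset_Icc_self)
        exact (continuous_id.sub continuous_const).rpow_const fun _ => Or.inr hd.le
      · filter_upwards [hβlim.eventually (lt_mem_nhds two_pos),
          hVlim.eventually (gt_mem_nhds (show (1 / 2 : ℝ) < 1 by norm_num)),
          hVlim.eventually (lt_mem_nhds (show (0 : ℝ) < 1 / 2 by norm_num))] with d hd hd1 hd0
        refine Eventually.of_forall fun u hu => ?_
        rw [uIoc_of_le hx1.le] at hu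
        have hsl : 0 ≤ slope k μ u := slope_nonneg (by linarith [hu.1])
        have h0 : 0 ≤ (u - x) ^ β d := Real.rpow_nonneg (by linarith [hu.1]) _
        have h1 : (u - x) ^ β d ≤ 1 :=
          Real.rpow_le_one (by linarith [hu.1]) (by linarith [hu.2]) hd.le
        rw [Real.norm_of_nonneg (by positivity)]
        exact mul_le_mul_of_nonneg_right (mul_le_one₀ h1 hd0.le hd1.le) hsl
      · exact (continuousOn_const.mul (continuousOn_slope (by linarith))).intervalIntegrable_of_Icc
          hx1.le
      · refine Eventually.of_forall fun u hu => ?_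
        rw [uIoc_of_le hx1.le] at hu
        have := ((hpow (u - x) (by linarith [hu.1])).mul hVlim).mul_const (slope k μ u)
        rwa [mul_one_div] at this
  intro W hW
  rw [mem_map, mem_curry_iff]
  -- For large `d` the set `W` is also a neighborhood of the inner limit, so the limit in `Λ` ends
  -- up in it.
  filter_upwards [houter.eventually (eventually_mem_nhds_iff.2 hW), eventually_gt_atTop k,
    eventually_ge_atTop 3] with d hd hkd hd3
  exact (tendsto_normShellSum_inner hkd hd3 (by linarith) hx1.le) hd


/-! ### Loop integrals, `ω` and the root factor -/

section Calculus

variable {μ x : ℝ} {k : ℕ}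

lemma continuousOn_inv_pow (hμ : 0 < μ) : ContinuousOn (fun u => ((u + μ) ^ k)⁻¹) (Icc 0 1) :=
  ContinuousOn.inv₀ (by fun_prop) fun u hu => by
    have : 0 < u + μ := by linarith [hu.1]
    positivity

lemma continuousOn_loopIntegrand (y : ℝ) (hμ : 0 < μ) :
    ContinuousOn (fun u => (u - y) / (u + μ) ^ k) (Icc 0 1) := by
  simp_rw [div_eq_mul_inv]
  exact ContinuousOn.mul (by fun_prop) (continuousOn_inv_pow hμ)

lemma loopIntegral_pos (hμ : 0 < μ) (hx : 0 ≤ x) (hx1 : x < 1) : 0 < loopIntegral μ k x := by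
  refine intervalIntegral.intervalIntegral_pos_of_pos_on
    (((continuousOn_loopIntegrand x hμ).mono (Icc_subset_Icc_left hx)).intervalIntegrable_of_Icc
      hx1.le) (fun u hu => ?_) hx1
  have : 0 < u - x := by linarith [hu.1]
  have : 0 < u + μ := by linarith [hu.1]
  positivity

/-- Splitting `u - x` removes `x` from the integrands and leaves primitives of fixed continuous
functions. -/
lemma continuousOn_loopIntegral (hμ : 0 < μ) : ContinuousOn (loopIntegral μ k) (Icc 0 1) := by
  have hprim (f : ℝ → ℝ) (hf : ContinuousOn f (Icc 0 1)) :
      ContinuousOn (fun x => ∫ u in x..1, f u) (Icc 0 1) := by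
    have h := intervalIntegral.continuousOn_primitive_interval' (a := 1)
      (hf.intervalIntegrable_of_Icc (μ := volume) zero_le_one) (by simp)
    rw [uIcc_of_le zero_le_one] at h
    exact h.neg.congr fun x _ => intervalIntegral.integral_symm _ _
  have hf := continuousOn_loopIntegrand (k := k) 0 hμ
  have hg := continuousOn_inv_pow (k := k) hμ
  refine ((hprim _ hf).sub (continuousOn_id.mul (hprim _ hg))).congr fun x hx => ?_
  simp only [Pi.sub_apply, Pi.mul_apply, id]
  rw [loopIntegral, ← intervalIntegral.integral_const_mul, ← intervalIntegral.integral_sub]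
  · exact intervalIntegral.integral_congr fun u _ => by ring
  · exact (hf.mono (Icc_subset_Icc_left hx.1)).intervalIntegrable_of_Icc hx.2
  · exact (continuousOn_const.mul
      (hg.mono (Icc_subset_Icc_left hx.1))).intervalIntegrable_of_Icc hx.2

/-- Differentiation under the integral sign; staying in `t > μ / 2` keeps the denominators away from
zero. -/
lemma hasDerivAt_loopIntegral (hμ : 0 < μ) (hx : 0 ≤ x) (hx1 : x ≤ 1) :
    HasDerivAt (fun t => loopIntegral t k x) (-k * loopIntegral μ (k + 1) x) μ := by
  have hmeas (t : ℝ) (ht : 0 < t) (j : ℕ) :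
      AEStronglyMeasurable (fun u => (u - x) / (u + t) ^ j) (volume.restrict (uIoc x 1)) := by
    rw [uIoc_of_le hx1]
    exact ((continuousOn_loopIntegrand x ht).mono
      fun u hu => ⟨hx.trans hu.1.le, hu.2⟩).aestronglyMeasurable measurableSet_Ioc
  have h := intervalIntegral.hasDerivAt_integral_of_dominated_loc_of_deriv_le (μ := volume)
    (a := x) (b := 1) (F := fun t u => (u - x) / (u + t) ^ k)
    (F' := fun t u => -k * ((u - x) / (u + t) ^ (k + 1))) (x₀ := μ) (s := Ioi (μ / 2))
    (bound := fun _ => k * (1 / (μ / 2) ^ (k + 1))) (Ioi_mem_nhds (by linarith))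
    (by
      filter_upwards [lt_mem_nhds hμ] with t ht
      exact hmeas t ht k)
    (((continuousOn_loopIntegrand x hμ).mono (Icc_subset_Icc_left hx)).intervalIntegrable_of_Icc
      hx1)
    ((hmeas μ hμ (k + 1)).const_mul _)
    (Eventually.of_forall fun u hu t ht => by
      rw [uIoc_of_le hx1] at hu
      have ht' : μ / 2 < t := ht
      have h1 : 0 ≤ u - x := by linarith [hu.1]
      have h2 : μ / 2 ≤ u + t := by linarith [hu.1]
      have h3 : 0 < u + t := by linarith
      rw [norm_mul, norm_neg, Real.norm_natCast, Real.norm_of_nonneg (by positivity)]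
      gcongr
      linarith [hu.2])
    intervalIntegrable_const
    (Eventually.of_forall fun u hu t ht => by
      rw [uIoc_of_le hx1] at hu
      have ht' : μ / 2 < t := ht
      have h3 : 0 < t + u := by linarith [hu.1]
      have := (hasDerivAt_inv_pow (k := k) h3).const_mul (u - x)
      convert! this using 1
      · ext t; rw [div_eq_mul_inv, add_comm]
      · rw [slope, add_comm u t]; ring)
  have e : -(k : ℝ) * loopIntegral μ (k + 1) x =
      ∫ u in x..1, -(k : ℝ) * ((u - x) / (u + μ) ^ (k + 1)) :=
    (intervalIntegral.integral_const_mul _ _).symm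
  rw [e]
  exact h.2

lemma iteratedDeriv_loopIntegral (hx : 0 ≤ x) (hx1 : x ≤ 1) (j : ℕ) : ∀ {t : ℝ}, 0 < t →
    iteratedDeriv j (fun t => loopIntegral t 1 x) t =
      (-1) ^ j * j.factorial * loopIntegral t (j + 1) x := by
  induction j with
  | zero => simp
  | succ j ih =>
    intro t ht
    rw [iteratedDeriv_succ]
    have : iteratedDeriv j (fun t => loopIntegral t 1 x) =ᶠ[𝓝 t]
        fun t => (-1) ^ j * j.factorial * loopIntegral t (j + 1) x := by
      filter_upwards [lt_mem_nhds ht] with t ht using ih ht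
    rw [this.deriv_eq, ((hasDerivAt_loopIntegral ht hx hx1).const_mul _).deriv,
      Nat.factorial_succ]
    push_cast
    ring

lemma loopIntegral_one (hμ : 0 < μ) (hx : 0 ≤ x) (hx1 : x ≤ 1) :
    loopIntegral μ 1 x = 1 - x - (μ + x) * Real.log ((1 + μ) / (μ + x)) := by
  have h := intervalIntegral.integral_eq_sub_of_hasDerivAt (a := x) (b := 1)
    (f := fun u => u - (μ + x) * Real.log (u + μ)) (f' := fun u => (u - x) / (u + μ) ^ 1)
    (fun u hu => by
      rw [uIcc_of_le hx1] at hu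
      have hu0 : u + μ ≠ 0 := by linarith [hu.1]
      have := (hasDerivAt_id u).sub
        ((((hasDerivAt_id u).add_const μ).log hu0).const_mul (μ + x))
      convert! this using 1
      simp only [id]
      field_simp
      ring)
    (((continuousOn_loopIntegrand x hμ).mono (Icc_subset_Icc_left hx)).intervalIntegrable_of_Icc
      hx1)
  rw [loopIntegral, h, Real.log_div (by linarith) (by linarith), add_comm x μ]
  ring

lemma hasDerivAt_omega (hμ : 0 < μ) : HasDerivAt omega (loopIntegral μ 1 0) μ := by
  have h1 : 1 + μ ≠ 0 := by linarith
  have hl := (((hasDerivAt_id μ).const_add 1).log h1)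
  have hq := ((((hasDerivAt_id μ).const_add 1).fun_div (hasDerivAt_id μ) hμ.ne').log
    (by simp only [id]; positivity))
  have h := (((hl.add (hasDerivAt_id μ)).sub (((hasDerivAt_id μ).fun_pow 2).fun_mul hq)).const_mul
    (1 / 2 : ℝ))
  have e : omega = fun t : ℝ => 1 / 2 *
      (Real.log (1 + t) + t - t ^ 2 * Real.log ((1 + t) / t)) := rfl
  rw [e]
  convert! h using 1
  rw [loopIntegral_one hμ le_rfl zero_le_one]
  simp only [id, sub_zero, add_zero]
  field_simp
  ring

lemma iteratedDeriv_omega (hμ : 0 < μ) (hk : 1 ≤ k) :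
    iteratedDeriv k omega μ = (-1) ^ (k - 1) * (k - 1).factorial * loopIntegral μ k 0 := by
  obtain ⟨j, rfl⟩ := Nat.exists_eq_add_of_le' hk
  rw [iteratedDeriv_succ', add_tsub_cancel_right,
    ← iteratedDeriv_loopIntegral le_rfl zero_le_one j hμ]
  refine Filter.EventuallyEq.iteratedDeriv_eq j ?_
  filter_upwards [lt_mem_nhds hμ] with t ht using (hasDerivAt_omega ht).deriv

/-- The bracket defining the root factor is `(1 - x)⁻¹` times the loop integral with `k = 1`, so its
derivatives are already known. -/
lemma rootFactor_eq (hμ : 0 < μ) (hk : 1 ≤ k) (hx : 0 ≤ x) (hx1 : x < 1) :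
    rootFactor k μ x = (-1) ^ (k - 1) * ((1 - x)⁻¹ * loopIntegral μ k x) := by
  obtain ⟨j, rfl⟩ := Nat.exists_eq_add_of_le' hk
  rw [add_tsub_cancel_right, rootFactor, add_tsub_cancel_right]
  have hev : (fun t : ℝ => 1 - (t + x) / (1 - x) * Real.log ((1 + t) / (t + x))) =ᶠ[𝓝 μ]
      fun t => (1 - x)⁻¹ * loopIntegral t 1 x := by
    filter_upwards [lt_mem_nhds hμ] with t ht
    have : 1 - x ≠ 0 := by linarith
    rw [loopIntegral_one ht hx hx1.le]
    field_simp
  rw [hev.iteratedDeriv_eq j]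
  have hc : iteratedDeriv j (fun t => (1 - x)⁻¹ * loopIntegral t 1 x) μ =
      (1 - x)⁻¹ * iteratedDeriv j (fun t => loopIntegral t 1 x) μ :=
    iteratedDeriv_const_mul_field _ _
  rw [hc, iteratedDeriv_loopIntegral hx hx1.le j hμ]
  have : (j.factorial : ℝ) ≠ 0 := by positivity
  field_simp

theorem omega_eq_integral (hμ : 0 < μ) :
    omega μ = ∫ x in (0 : ℝ)..μ, ∫ y in (0 : ℝ)..1, y / (y + x) := by
  have hcont : ContinuousOn omega (Icc 0 μ) := by
    have h1 : ContinuousOn (fun t : ℝ => Real.log (1 + t)) (Icc 0 μ) :=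
      ContinuousOn.log (by fun_prop) fun t ht => by linarith [ht.1]
    -- The only singular term at `0` is `t ^ 2 * log t`, and it extends continuously.
    have h2 : Continuous fun t : ℝ => t * (t * Real.log t) :=
      continuous_id.mul Real.continuous_mul_log
    refine (continuousOn_const (c := (1 / 2 : ℝ))).mul (((h1.add continuousOn_id).sub
      (((continuousOn_id.pow 2).mul h1).sub h2.continuousOn)).congr fun t ht => ?_)
    rcases ht.1.eq_or_lt with rfl | h
    · simp
    · rw [Real.log_div (by linarith) h.ne']
      simp only [Pi.sub_apply, Pi.add_apply, Pi.mul_apply, Pi.pow_apply, id]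
      ring
  have hderiv : ∀ t ∈ Ioo 0 μ, HasDerivAt omega (loopIntegral t 1 0) t :=
    fun t ht => hasDerivAt_omega ht.1
  -- A nonnegative derivative of a function continuous up to the endpoints is integrable, so no
  -- estimate near `t = 0` is needed.
  have hint : IntervalIntegrable (fun t => loopIntegral t 1 0) volume 0 μ := by
    rw [intervalIntegrable_iff_integrableOn_Ioc_of_le hμ.le]
    exact intervalIntegral.integrableOn_deriv_of_nonneg hcont hderiv
      fun t ht => (loopIntegral_pos ht.1 le_rfl zero_lt_one).le
  have h := intervalIntegral.integral_eq_sub_of_hasDerivAt_of_le hμ.le hcont hderiv hint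
  have h0 : omega 0 = 0 := by simp [omega]
  rw [h0, sub_zero] at h
  rw [← h]
  simp only [loopIntegral, sub_zero, pow_one]

end Calculus


/-! ### Uniformity in the offset -/

lemma normShellSum_nonneg {k d : ℕ} {μ Λ x : ℝ} (hd : 2 ≤ d) (hΛ : 0 < Λ) (hx : 0 ≤ x + μ) :
    0 ≤ normShellSum k μ d Λ x := by
  have := iota_pos hd
  have := shellSum_nonneg (I := Fin (d - k)) (s := 2 * eta d) (k := k) hΛ hx
  unfold normShellSum
  positivity

lemma normShellSum_anti {k d : ℕ} {μ Λ x y : ℝ} (hd : 2 ≤ d) (hΛ : 0 < Λ) (hx : 0 < x + μ)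
    (hxy : x ≤ y) : normShellSum k μ d Λ y ≤ normShellSum k μ d Λ x := by
  have := iota_pos hd
  have := shellSum_anti (I := Fin (d - k)) (k := k) (two_mul_eta_pos hd) hΛ hx hxy
  unfold normShellSum
  gcongr

lemma eventually_curry_fst {p : ℕ → Prop} (h : ∀ᶠ d in atTop, p d) :
    ∀ᶠ z : ℕ × ℝ in atTop.curry atTop, p z.1 :=
  h.mono fun _ hd => Eventually.of_forall fun _ => hd

lemma eventually_curry_snd {p : ℝ → Prop} (h : ∀ᶠ Λ in atTop, p Λ) :
    ∀ᶠ z : ℕ × ℝ in atTop.curry atTop, p z.2 :=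
  eventually_curry_iff.2 (Eventually.of_forall fun _ => h)

/-- Pointwise convergence of monotone functions to a continuous limit is uniform: a finite grid
suffices. The slack `σ` in the lower bound is there to absorb the offset due to small edge momenta.
-/
lemma eventually_normShellSum_bounds {k : ℕ} {μ δ e : ℝ} (hk : 1 ≤ k) (hμ : 0 < μ) (hδ : 0 < δ)
    (he : 0 < e) :
    ∀ᶠ σ : ℝ in 𝓝[>] 0, ∀ᶠ z : ℕ × ℝ in atTop.curry atTop, ∀ x, 0 ≤ x → x ≤ 1 - δ →
      normShellSum k μ z.1 z.2 x ≤ (1 + e) * loopIntegral μ k x ∧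
      ∀ y ≤ x + σ, 0 ≤ y → (1 - e) * loopIntegral μ k x ≤ normShellSum k μ z.1 z.2 y := by
  rcases lt_or_ge 1 δ with h1 | h1
  · exact Eventually.of_forall fun σ => Eventually.of_forall fun z x hx hx' => by linarith
  have hcont := continuousOn_loopIntegral (k := k) hμ
  obtain ⟨x₀, hx₀, hmin⟩ := isCompact_Icc.exists_isMinOn (s := Icc (0 : ℝ) (1 - δ))
    ⟨0, le_rfl, by linarith⟩ (hcont.mono (Icc_subset_Icc_right (by linarith)))
  set c := loopIntegral μ k x₀ with hc
  have hc0 : 0 < c := loopIntegral_pos hμ hx₀.1 (by linarith [hx₀.2])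
  have hcle : ∀ x, 0 ≤ x → x ≤ 1 - δ → c ≤ loopIntegral μ k x := fun x h h' => hmin ⟨h, h'⟩
  -- As `c` is the minimum of the limit, a relative error `e` allows an absolute error `e * c`: half
  -- for convergence on the grid, half for continuity.
  have hec : 0 < e * c / 2 := by positivity
  obtain ⟨h₀, hh₀, hunif⟩ := Metric.uniformContinuousOn_iff.1
    (isCompact_Icc.uniformContinuousOn_of_continuous hcont) _ hec
  -- The grid points used lie within `2 * h` of `x`, and `8 * h ≤ δ` keeps them inside the grid,
  -- which ends at or below `1 - δ / 2`.
  obtain ⟨h, hpos, hh1, hh2⟩ : ∃ h : ℝ, 0 < h ∧ 3 * h ≤ h₀ ∧ 8 * h ≤ δ :=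
    ⟨min (h₀ / 3) (δ / 8), by positivity, by linarith [min_le_left (h₀ / 3) (δ / 8)],
      by linarith [min_le_right (h₀ / 3) (δ / 8)]⟩
  have hclose : ∀ x y, 0 ≤ x → x ≤ 1 → 0 ≤ y → y ≤ 1 → |x - y| < 3 * h →
      |loopIntegral μ k x - loopIntegral μ k y| < e * c / 2 := fun x y h1 h2 h3 h4 h5 => by
    have := hunif x ⟨h1, h2⟩ y ⟨h3, h4⟩ (by rw [Real.dist_eq]; linarith)
    rwa [Real.dist_eq] at this
  obtain ⟨N, hN⟩ : ∃ N : ℕ, N * h ≤ 1 - δ / 2 ∧ 1 - δ / 2 < (N + 1) * h := by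
    refine ⟨⌊(1 - δ / 2) / h⌋₊, ?_, ?_⟩
    · rw [← le_div_iff₀ hpos]
      exact Nat.floor_le (by apply div_nonneg <;> linarith)
    · rw [← div_lt_iff₀ hpos]
      exact Nat.lt_floor_add_one _
  have hgrid : ∀ᶠ z : ℕ × ℝ in atTop.curry atTop, ∀ j ∈ Finset.range (N + 1),
      |normShellSum k μ z.1 z.2 (j * h) - loopIntegral μ k (j * h)| < e * c / 2 := by
    rw [eventually_all_finset]
    intro j hj
    have hjN : (j : ℝ) ≤ N := by exact_mod_cast Finset.mem_range_succ_iff.1 hj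
    have hj1 : j * h < 1 := by nlinarith [hN.1]
    have := tendsto_normShellSum hk hμ (by positivity : 0 ≤ j * h) hj1
    exact this.eventually (Metric.ball_mem_nhds _ hec)
  filter_upwards [Ioo_mem_nhdsGT hpos] with σ hσ
  filter_upwards [hgrid, eventually_curry_fst (eventually_ge_atTop 2),
    eventually_curry_snd (eventually_gt_atTop 0)] with z hz hd hΛ x hx hx1
  have hj1 := Nat.floor_le (div_nonneg hx hpos.le)
  have hj2 := Nat.lt_floor_add_one (x / h)
  -- The point `j * h ≤ x` serves the upper bound. For the lower one, `σ < h` gives `y ≤ x + σ < (j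
  -- + 2) * h`.
  set j := ⌊x / h⌋₊
  rw [le_div_iff₀ hpos] at hj1
  rw [div_lt_iff₀ hpos] at hj2
  have hjN : j + 2 ≤ N := by
    have : ((j : ℝ) + 2) * h < (N + 1) * h := by linarith [hN.2]
    have := lt_of_mul_lt_mul_right this hpos.le
    have : ((j + 2 : ℕ) : ℝ) < (N + 1 : ℕ) := by push_cast; exact this
    have := Nat.cast_lt.1 this
    omega
  have hcx := mul_le_mul_of_nonneg_left (hcle x hx hx1) he.le
  constructor
  · have hg := (abs_lt.1 (hz j (by rw [Finset.mem_range]; omega))).2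
    have ha := normShellSum_anti (k := k) (μ := μ) hd hΛ
      (by positivity : 0 < (j : ℝ) * h + μ) hj1
    have hcl := (abs_lt.1 (hclose (j * h) x (by positivity) (by linarith) hx (by linarith)
      (by rw [abs_lt]; constructor <;> linarith))).2
    linarith
  · intro y hy hy0
    have hg := (abs_lt.1 (hz (j + 2) (by rw [Finset.mem_range]; omega))).1
    push_cast at hg
    have ha := normShellSum_anti (k := k) (μ := μ) hd hΛ (by linarith : 0 < y + μ)
      (by linarith [hσ.2] : y ≤ (j + 2) * h)
    have hcl := (abs_lt.1 (hclose ((j + 2) * h) x (by positivity) (by linarith) hx (by linarith)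
      (by rw [abs_lt]; constructor <;> linarith))).1
    linarith

lemma eventually_normShellSum_bounds_uniform {μ δ e : ℝ} (n : ℕ) (hμ : 0 < μ) (hδ : 0 < δ)
    (he : 0 < e) :
    ∀ᶠ σ : ℝ in 𝓝[>] 0, ∀ᶠ z : ℕ × ℝ in atTop.curry atTop, ∀ k, 1 ≤ k → k ≤ n →
      ∀ x, 0 ≤ x → x ≤ 1 - δ →
      normShellSum k μ z.1 z.2 x ≤ (1 + e) * loopIntegral μ k x ∧
      ∀ y ≤ x + σ, 0 ≤ y → (1 - e) * loopIntegral μ k x ≤ normShellSum k μ z.1 z.2 y := by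
  have h := (eventually_all_finset (Finset.Icc 1 n)).2 fun k hk =>
    eventually_normShellSum_bounds (Finset.mem_Icc.1 hk).1 hμ hδ he
  filter_upwards [h] with σ hσ
  filter_upwards [(eventually_all_finset (Finset.Icc 1 n)).2 hσ] with z hz k hk hkn
  exact hz k (Finset.mem_Icc.2 ⟨hk, hkn⟩)


/-! ### The propagators of a single loop vertex -/

lemma normPow_eq {d : ℕ} {Λ : ℝ} (hΛ : 0 < Λ) (v : Fin d → ℤ) :
    normPow v = Λ ^ (2 * eta d) * powSum (2 * eta d) Λ v := by
  unfold normPow powSum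
  rw [Finset.mul_sum]
  refine Finset.sum_congr rfl fun i _ => ?_
  rw [Real.div_rpow (abs_nonneg _) hΛ.le, mul_div_cancel₀ _ (by positivity)]

lemma propagator_pow {d k : ℕ} {Λ m μ : ℝ} (hΛ : 0 < Λ) (hm : 0 < m)
    (hμ : (m / Λ) ^ (2 * eta d) = μ) (hk : k ≠ 0) (v : Fin d → ℤ) :
    propagator Λ m v ^ k = ((Λ ^ (2 * eta d)) ^ k)⁻¹ * cut k μ (powSum (2 * eta d) Λ v) := by
  have hA : 0 < Λ ^ (2 * eta d) := by positivity
  have hm' : m ^ (2 * eta d) = Λ ^ (2 * eta d) * μ := by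
    rw [← hμ, Real.div_rpow hm.le hΛ.le, mul_div_cancel₀ _ hA.ne']
  unfold propagator cut
  simp only [normPow_eq hΛ, hm', mul_le_iff_le_one_right hA]
  split_ifs with h
  · rw [← mul_add, one_div, inv_pow, mul_pow, mul_inv]
  · simp [hk]

lemma propagator_eq_zero {d : ℕ} {Λ m : ℝ} (hd : 2 ≤ d) (hΛ : 0 < Λ) {v : Fin d → ℤ} {i : Fin d}
    (hi : v i ∉ Finset.Icc (-⌈Λ⌉) ⌈Λ⌉) : propagator Λ m v = 0 := by
  refine if_neg fun h => hi ?_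
  have hs := two_mul_eta_pos hd
  have h1 : |(v i : ℝ)| ^ (2 * eta d) ≤ Λ ^ (2 * eta d) :=
    (Finset.single_le_sum (f := fun i => |(v i : ℝ)| ^ (2 * eta d))
      (fun i _ => by positivity) (Finset.mem_univ i)).trans h
  rw [Real.rpow_le_rpow_iff (abs_nonneg _) hΛ.le hs] at h1
  have h2 : |v i| ≤ ⌈Λ⌉ := by exact_mod_cast h1.trans (Int.le_ceil Λ)
  exact Finset.mem_Icc.2 (abs_le.1 h2)

/-- The sum over the momenta of a loop vertex, with the components in `s` prescribed. -/
lemma sum_propagator_pow {d k : ℕ} {Λ m μ : ℝ} (hd : 2 ≤ d) (hΛ : 0 < Λ) (hm : 0 < m)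
    (hμ : (m / Λ) ^ (2 * eta d) = μ) (hk : k ≠ 0) (s : Finset (Fin d)) (Q : Fin d → ℤ) :
    ∑ v ∈ Fintype.piFinset (fun _ => Finset.Icc (-⌈Λ⌉) ⌈Λ⌉) with ∀ i ∈ s, v i = Q i,
        propagator Λ m v ^ k =
      ((Λ ^ (2 * eta d)) ^ k)⁻¹ * shellSum (Fin (d - s.card)) (2 * eta d) k Λ μ
        (∑ i ∈ s, (|(Q i : ℝ)| / Λ) ^ (2 * eta d)) := by
  classical
  set f : (Fin d → ℤ) → ℝ := fun v => if ∀ i ∈ s, v i = Q i then propagator Λ m v ^ k else 0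
  set g : ({i // i ∉ s} → ℤ) → Fin d → ℤ := fun w i => if h : i ∈ s then Q i else w ⟨i, h⟩
  have hcard : Fintype.card {i // i ∉ s} = d - s.card := by
    rw [Fintype.card_subtype_compl, Fintype.card_fin, Fintype.card_coe]
  have hg : Function.Injective g := by
    intro w w' h
    ext ⟨i, hi⟩
    simpa [g, hi] using congrFun h i
  have hsupp : Function.support f ⊆ range g := by
    intro v hv
    have hv' : ∀ i ∈ s, v i = Q i := by
      by_contra h
      exact hv (if_neg h)
    refine ⟨fun i => v i, funext fun i => ?_⟩
    by_cases hi : i ∈ s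
    · simp [g, hi, hv' i hi]
    · simp [g, hi]
  have h1 : ∑' v, f v = ∑ v ∈ Fintype.piFinset (fun _ => Finset.Icc (-⌈Λ⌉) ⌈Λ⌉) with
      ∀ i ∈ s, v i = Q i, propagator Λ m v ^ k := by
    rw [Finset.sum_filter]
    refine tsum_eq_sum fun v hv => ?_
    rw [Fintype.mem_piFinset] at hv
    push Not at hv
    obtain ⟨i, hi⟩ := hv
    simp [f, propagator_eq_zero hd hΛ hi, hk]
  rw [← h1, ← hg.tsum_eq hsupp, ← shellSum_congr (Fintype.equivFinOfCardEq hcard), shellSum,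
    ← tsum_mul_left]
  refine tsum_congr fun w => ?_
  have hgs : ∀ i ∈ s, g w i = Q i := fun i hi => by simp [g, hi]
  simp only [f]
  rw [if_pos hgs, propagator_pow hΛ hm hμ hk]
  congr 2
  unfold powSum
  rw [← Finset.sum_add_sum_compl s]
  congr 1
  · exact Finset.sum_congr rfl fun i hi => by rw [hgs i hi]
  · rw [Finset.sum_subtype sᶜ (p := (· ∉ s)) fun i => Finset.mem_compl]
    exact Fintype.sum_congr _ _ fun i => by simp [g, i.2]

/-! ### Face constraints and factorization of the amplitude -/

namespace TwoPointTree

variable {n d : ℕ} (T : TwoPointTree n d)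

open Classical in
/-- The colors of the edges hooked to a loop vertex. -/
def colorsAt (b : Fin n) : Finset (Fin d) :=
  ({e : T.graph.edgeSet | b ∈ (e : Sym2 (Fin n))} : Finset _).image T.color ∪
    if b = T.root then {T.rootColor} else ∅

lemma mem_colorsAt {b : Fin n} {i : Fin d} : i ∈ T.colorsAt b ↔
    (∃ e : T.graph.edgeSet, b ∈ (e : Sym2 (Fin n)) ∧ T.color e = i) ∨
      (b = T.root ∧ i = T.rootColor) := by
  unfold colorsAt
  split_ifs with h <;> simp [h, or_comm]

lemma card_colorsAt (hT : T.DistinctColors) (b : Fin n) : (T.colorsAt b).card = T.coord b := by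
  classical
  have h1 : (({e : T.graph.edgeSet | b ∈ (e : Sym2 (Fin n))} : Finset _).image T.color).card =
      T.graph.degree b := by
    rw [Finset.card_image_of_injective _ hT.1, ← T.graph.card_incidenceFinset_eq_degree,
      ← Finset.card_map (Function.Embedding.subtype _)]
    congr 1
    ext e
    simp [SimpleGraph.incidenceSet, and_comm]
  unfold colorsAt coord
  rw [Finset.card_union_of_disjoint]
  · congr 1
    split_ifs <;> simp
  · split_ifs
    · simpa using fun e _ he => hT.2 ⟨e, he⟩
    · simp

lemma pos_of_root (T : TwoPointTree n d) : 0 < n := Fin.pos T.root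

lemma coord_pos (b : Fin n) : 1 ≤ T.coord b := by
  classical
  unfold coord
  split_ifs with h
  · omega
  · have : Nontrivial (Fin n) := ⟨b, T.root, h⟩
    simpa using! T.isTree.connected.preconnected.degree_pos_of_nontrivial b

lemma coord_le (b : Fin n) : T.coord b ≤ n := by
  classical
  have h := T.graph.degree_lt_card_verts b
  rw [Fintype.card_fin] at h
  unfold coord
  split_ifs
  · simpa using! h
  · simpa using! h.le

lemma card_edgeSet : Nat.card T.graph.edgeSet = n - 1 := by
  classical
  have h := T.isTree.card_edgeFinset
  rw [Fintype.card_fin] at h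
  rw [Nat.card_eq_fintype_card, ← SimpleGraph.edgeFinset_card]
  omega

/-- Handshake: the `n - 1` edges count twice, the external one once. -/
lemma sum_coord : ∑ b, T.coord b = 2 * n - 1 := by
  classical
  have h := T.graph.sum_degrees_eq_twice_card_edges
  have h' := T.isTree.card_edgeFinset
  rw [Fintype.card_fin] at h'
  have : ∑ b, T.coord b = ∑ b, T.graph.degree b + 1 := by
    unfold coord
    rw [Finset.sum_add_distrib]
    simp
  omega

open Classical in
/-- The momenta carried by the colors of the tree, with the edge momenta bounded by `L` and the
external momentum equal to `p`. -/
def edgeMomenta (p L : ℤ) : Finset (Fin d → ℤ) :=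
  Fintype.piFinset fun i => if i = T.rootColor then {p} else
    if i ∈ Finset.univ.image T.color then Finset.Icc (-L) L else {0}

lemma card_edgeMomenta (hT : T.DistinctColors) (p : ℤ) {L : ℤ} (hL : 0 ≤ L) :
    ((T.edgeMomenta p L).card : ℝ) = (2 * L + 1) ^ (n - 1) := by
  classical
  unfold edgeMomenta
  rw [Fintype.card_piFinset]
  have h1 : ∀ i : Fin d, (if i = T.rootColor then {p} else
      if i ∈ Finset.univ.image T.color then Finset.Icc (-L) L else {0} : Finset ℤ).card =
      if i ∈ Finset.univ.image T.color then (2 * L + 1).toNat else 1 := by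
    intro i
    by_cases hi : i = T.rootColor
    · have : i ∉ Finset.univ.image T.color := by
        simpa [hi] using fun e he => hT.2 ⟨e, he⟩
      rw [if_pos hi, if_neg this, Finset.card_singleton]
    · rw [if_neg hi]
      split_ifs
      · rw [Int.card_Icc]
        congr 1
        ring
      · simp
  have h2 : (Finset.univ.image T.color).card = n - 1 := by
    rw [Finset.card_image_of_injective _ hT.1, Finset.card_univ, ← T.card_edgeSet,
      Nat.card_eq_fintype_card]
  simp_rw [h1]
  rw [Finset.prod_ite_mem, Finset.univ_inter, Finset.prod_const, h2]
  push_cast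
  congr 1
  rw [← Int.cast_natCast, Int.toNat_of_nonneg (by omega)]
  push_cast
  ring

lemma edgeMomenta_mono {p L L' : ℤ} (h : L ≤ L') : T.edgeMomenta p L ⊆ T.edgeMomenta p L' := by
  classical
  unfold edgeMomenta
  refine Fintype.piFinset_subset _ _ fun i => ?_
  split_ifs
  · rfl
  · exact Finset.Icc_subset_Icc (by omega) h
  · rfl

lemma eq_of_mem_edgeMomenta {p L : ℤ} {Q : Fin d → ℤ} (hQ : Q ∈ T.edgeMomenta p L) :
    Q T.rootColor = p := by
  classical
  simpa using Fintype.mem_piFinset.1 hQ T.rootColor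

lemma abs_le_of_mem_edgeMomenta {p L : ℤ} (hL : 0 ≤ L) {Q : Fin d → ℤ}
    (hQ : Q ∈ T.edgeMomenta p L) {i : Fin d} (hi : i ≠ T.rootColor) : |Q i| ≤ L := by
  classical
  have h := Fintype.mem_piFinset.1 hQ i
  rw [if_neg hi] at h
  split_ifs at h
  · exact abs_le.2 (Finset.mem_Icc.1 h)
  · rw [Finset.mem_singleton] at h
    simpa [h] using hL

/-- For momenta in a box, the face constraint says that there are edge momenta that the loop
vertices share. -/
lemma faceConstraint_iff (hT : T.DistinctColors) {p L : ℤ} {P : Fin n → Fin d → ℤ}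
    (hP : ∀ b i, P b i ∈ Finset.Icc (-L) L) :
    T.FaceConstraint p P ↔ ∃ Q ∈ T.edgeMomenta p L, ∀ b, ∀ i ∈ T.colorsAt b, P b i = Q i := by
  classical
  constructor
  · rintro ⟨hroot, hedge⟩
    have hedge' : ∀ (e : T.graph.edgeSet) (u v : Fin n), u ∈ (e : Sym2 (Fin n)) →
        v ∈ (e : Sym2 (Fin n)) → P u (T.color e) = P v (T.color e) := by
      rintro ⟨e, he⟩ u v hu hv
      by_cases huv : u = v
      · rw [huv]
      · have he' : e = s(u, v) := (Sym2.mem_and_mem_iff huv).1 ⟨hu, hv⟩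
        subst he'
        exact hedge u v (T.graph.mem_edgeSet.1 he)
    -- By injectivity of the coloring the chosen edge is the only one of color `i`, and the
    -- constraint makes the choice of its endpoint immaterial.
    refine ⟨fun i => if i = T.rootColor then p else
      if h : ∃ e, T.color e = i then P (h.choose : Sym2 (Fin n)).out.1 i else 0, ?_, ?_⟩
    · refine Fintype.mem_piFinset.2 fun i => ?_
      by_cases hi : i = T.rootColor
      · simp [hi]
      · simp only [if_neg hi]
        by_cases h : ∃ e, T.color e = i
        · rw [dif_pos h, if_pos (by simpa using h)]
          exact hP _ _
        · rw [dif_neg h, if_neg (by simpa using h)]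
          simp
    · intro b i hi
      rcases T.mem_colorsAt.1 hi with ⟨e, hbe, rfl⟩ | ⟨rfl, rfl⟩
      · have h : ∃ e', T.color e' = T.color e := ⟨e, rfl⟩
        simp only
        rw [if_neg (hT.2 e), dif_pos h, hT.1 h.choose_spec]
        exact hedge' e _ _ hbe (Sym2.out_fst_mem _)
      · simp [hroot]
  · rintro ⟨Q, hQ, hPQ⟩
    refine ⟨?_, fun u v h => ?_⟩
    · rw [hPQ _ _ (T.mem_colorsAt.2 (Or.inr ⟨rfl, rfl⟩)), T.eq_of_mem_edgeMomenta hQ]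
    · rw [hPQ u _ (T.mem_colorsAt.2 (Or.inl ⟨_, Sym2.mem_mk_left u v, rfl⟩)),
        hPQ v _ (T.mem_colorsAt.2 (Or.inl ⟨_, Sym2.mem_mk_right u v, rfl⟩))]

/-- Colors absent from the tree are pinned to `0` in `edgeMomenta`, so a vertex family determines
its `Q` and the fibers over different `Q` are disjoint. -/
lemma edgeMomenta_ext {p L : ℤ} {Q Q' : Fin d → ℤ} (hQ : Q ∈ T.edgeMomenta p L)
    (hQ' : Q' ∈ T.edgeMomenta p L) (h : ∀ b, ∀ i ∈ T.colorsAt b, Q i = Q' i) : Q = Q' := by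
  classical
  funext i
  by_cases hi : i = T.rootColor
  · rw [hi, T.eq_of_mem_edgeMomenta hQ, T.eq_of_mem_edgeMomenta hQ']
  · by_cases hc : i ∈ Finset.univ.image T.color
    · obtain ⟨e, -, rfl⟩ := Finset.mem_image.1 hc
      exact h _ _ (T.mem_colorsAt.2 (Or.inl ⟨e, Sym2.out_fst_mem _, rfl⟩))
    · have h1 := Fintype.mem_piFinset.1 hQ i
      have h2 := Fintype.mem_piFinset.1 hQ' i
      rw [if_neg hi, if_neg hc, Finset.mem_singleton] at h1 h2
      rw [h1, h2]

/-- The power sum of the momenta of the edges hooked to a loop vertex, in units of the cutoff. -/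
def offset (Λ : ℝ) (Q : Fin d → ℤ) (b : Fin n) : ℝ :=
  ∑ i ∈ T.colorsAt b, (|(Q i : ℝ)| / Λ) ^ (2 * eta d)

/-- The admissible families in the box are partitioned by their edge momenta; on each fiber the
vertices are independent, so the sum of products is a product of sums. -/
theorem amplitude_eq_sum (hT : T.DistinctColors) {Λ m μ : ℝ} (hd : 2 ≤ d) (hΛ : 0 < Λ)
    (hm : 0 < m) (hμ : (m / Λ) ^ (2 * eta d) = μ) (p : ℤ) :
    T.amplitude Λ m p = ∑ Q ∈ T.edgeMomenta p ⌈Λ⌉, ∏ b,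
      (((Λ ^ (2 * eta d)) ^ T.coord b)⁻¹ *
        shellSum (Fin (d - T.coord b)) (2 * eta d) (T.coord b) Λ μ (T.offset Λ Q b)) := by
  classical
  set box : Finset (Fin d → ℤ) := Fintype.piFinset fun _ => Finset.Icc (-⌈Λ⌉) ⌈Λ⌉ with hbox
  have h1 : T.amplitude Λ m p = ∑ P ∈ Fintype.piFinset fun _ : Fin n => box,
      if T.FaceConstraint p P then ∏ b, propagator Λ m (P b) ^ T.coord b else 0 := by
    unfold amplitude
    refine tsum_eq_sum fun P hP => ?_
    simp only [hbox, Fintype.mem_piFinset] at hP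
    push Not at hP
    obtain ⟨b, i, hi⟩ := hP
    have : ∏ b, propagator Λ m (P b) ^ T.coord b = 0 :=
      Finset.prod_eq_zero (Finset.mem_univ b) (by
        rw [propagator_eq_zero hd hΛ hi, zero_pow (by have := T.coord_pos b; omega)])
    rw [this, ite_self]
  have h2 : ∀ Q : Fin d → ℤ, ∏ b, (((Λ ^ (2 * eta d)) ^ T.coord b)⁻¹ *
        shellSum (Fin (d - T.coord b)) (2 * eta d) (T.coord b) Λ μ (T.offset Λ Q b)) =
      ∑ P ∈ Fintype.piFinset fun b => {v ∈ box | ∀ i ∈ T.colorsAt b, v i = Q i},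
        ∏ b, propagator Λ m (P b) ^ T.coord b := by
    intro Q
    rw [← Finset.prod_univ_sum (fun b => {v ∈ box | ∀ i ∈ T.colorsAt b, v i = Q i})
      fun b v => propagator Λ m v ^ T.coord b]
    refine Finset.prod_congr rfl fun b _ => ?_
    have := sum_propagator_pow hd hΛ hm hμ (by have := T.coord_pos b; omega : T.coord b ≠ 0)
      (T.colorsAt b) Q
    rw [T.card_colorsAt hT] at this
    rw [hbox, offset, ← this]
  rw [h1, ← Finset.sum_filter, Finset.sum_congr rfl fun Q _ => h2 Q, ← Finset.sum_biUnion]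
  · refine Finset.sum_congr ?_ fun _ _ => rfl
    ext P
    simp only [Finset.mem_filter, Fintype.mem_piFinset, Finset.mem_biUnion]
    constructor
    · rintro ⟨hP, hF⟩
      obtain ⟨Q, hQ, hPQ⟩ :=
        (T.faceConstraint_iff hT fun b i => Fintype.mem_piFinset.1 (hP b) i).1 hF
      exact ⟨Q, hQ, fun b => ⟨hP b, hPQ b⟩⟩
    · rintro ⟨Q, hQ, hPQ⟩
      exact ⟨fun b => (hPQ b).1,
        (T.faceConstraint_iff hT fun b i => Fintype.mem_piFinset.1 (hPQ b).1 i).2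
          ⟨Q, hQ, fun b => (hPQ b).2⟩⟩
  · intro Q hQ Q' hQ' hne
    rw [Function.onFun, Finset.disjoint_left]
    intro P hP hP'
    simp only [Finset.mem_filter, Fintype.mem_piFinset] at hP hP'
    exact hne (T.edgeMomenta_ext hQ hQ' fun b i hi =>
      ((hP b).2 i hi).symm.trans ((hP' b).2 i hi))

end TwoPointTree


/-! ### Offsets, power counting and the coefficient -/

namespace TwoPointTree

variable {n d : ℕ} (T : TwoPointTree n d)

/-- The momentum that the external face carries through a loop vertex, raised to the power `2η`
and in units of the cutoff. -/
def external (x : ℝ) (b : Fin n) : ℝ := if b = T.root then x else 0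

lemma external_nonneg {x : ℝ} (hx : 0 ≤ x) (b : Fin n) : 0 ≤ T.external x b := by
  unfold external
  split_ifs
  exacts [hx, le_rfl]

lemma external_le {x y : ℝ} (hxy : x ≤ y) (hy : 0 ≤ y) (b : Fin n) : T.external x b ≤ y := by
  unfold external
  split_ifs
  exacts [hxy, hy]

lemma rootColor_mem_colorsAt (hT : T.DistinctColors) (b : Fin n) :
    T.rootColor ∈ T.colorsAt b ↔ b = T.root := by
  rw [T.mem_colorsAt]
  constructor
  · rintro (⟨e, -, he⟩ | ⟨h, -⟩)
    · exact absurd he (hT.2 e)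
    · exact h
  · exact fun h => Or.inr ⟨h, rfl⟩

lemma offset_eq (hT : T.DistinctColors) {p L : ℤ} {Λ : ℝ} {Q : Fin d → ℤ}
    (hQ : Q ∈ T.edgeMomenta p L) (b : Fin n) :
    T.offset Λ Q b = T.external ((|(p : ℝ)| / Λ) ^ (2 * eta d)) b +
      ∑ i ∈ (T.colorsAt b).erase T.rootColor, (|(Q i : ℝ)| / Λ) ^ (2 * eta d) := by
  unfold offset external
  split_ifs with h
  · rw [← Finset.add_sum_erase _ _ ((T.rootColor_mem_colorsAt hT b).2 h),
      T.eq_of_mem_edgeMomenta hQ]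
  · rw [Finset.erase_eq_of_notMem (mt (T.rootColor_mem_colorsAt hT b).1 h), zero_add]

lemma external_le_offset (hT : T.DistinctColors) {p L : ℤ} {Λ : ℝ} (hΛ : 0 < Λ) {Q : Fin d → ℤ}
    (hQ : Q ∈ T.edgeMomenta p L) (b : Fin n) :
    T.external ((|(p : ℝ)| / Λ) ^ (2 * eta d)) b ≤ T.offset Λ Q b := by
  rw [T.offset_eq hT hQ]
  exact le_add_of_nonneg_right (Finset.sum_nonneg fun i _ => by positivity)

/-- The box is chosen so that each internal edge contributes at most `σ`, and at most `n` edges meet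
at a vertex. -/
lemma offset_le (hT : T.DistinctColors) {p : ℤ} {Λ σ : ℝ} (hd : 2 ≤ d) (hΛ : 0 < Λ) (hσ : 0 < σ)
    {Q : Fin d → ℤ} (hQ : Q ∈ T.edgeMomenta p ⌊σ ^ (1 / (2 * eta d)) * Λ⌋) (b : Fin n) :
    T.offset Λ Q b ≤ T.external ((|(p : ℝ)| / Λ) ^ (2 * eta d)) b + n * σ := by
  have hs := two_mul_eta_pos hd
  rw [T.offset_eq hT hQ]
  gcongr
  have h1 : ∀ i ∈ (T.colorsAt b).erase T.rootColor, (|(Q i : ℝ)| / Λ) ^ (2 * eta d) ≤ σ := by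
    intro i hi
    have h := T.abs_le_of_mem_edgeMomenta (Int.floor_nonneg.2 (by positivity)) hQ
      (Finset.ne_of_mem_erase hi)
    have h' : |(Q i : ℝ)| ≤ σ ^ (1 / (2 * eta d)) * Λ := by
      refine le_trans ?_ (Int.floor_le _)
      exact_mod_cast h
    rw [← div_le_iff₀ hΛ] at h'
    refine (Real.rpow_le_rpow (by positivity) h' hs.le).trans (le_of_eq ?_)
    rw [← Real.rpow_mul hσ.le, one_div_mul_cancel hs.ne', Real.rpow_one]
  refine (Finset.sum_le_card_nsmul _ _ _ h1).trans ?_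
  rw [nsmul_eq_mul]
  gcongr
  exact (Finset.card_le_card (Finset.erase_subset _ _)).trans
    ((T.card_colorsAt hT b).trans_le (T.coord_le b))

lemma coord_le_dim (hT : T.DistinctColors) (b : Fin n) : T.coord b ≤ d := by
  rw [← T.card_colorsAt hT b]
  simpa using Finset.card_le_univ (T.colorsAt b)

lemma rpow_natCast_dim {Λ : ℝ} (hΛ : 0 < Λ) (d : ℕ) : Λ ^ d = (Λ ^ (2 * eta d)) ^ 2 * Λ := by
  rw [← Real.rpow_natCast, ← Real.rpow_natCast (Λ ^ (2 * eta d)), ← Real.rpow_mul hΛ.le,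
    ← Real.rpow_add_one hΛ.ne', two_mul_eta]
  congr 1
  push_cast
  ring

/-- Power counting. With `A = Λ ^ (2η)` one has `Λ ^ d = A ^ 2 * Λ`, so a vertex scales as `2 * ι(d)
* A ^ 2 * Λ / (2 * A * Λ) ^ m(b)`. Since the `m(b)` add up to `2 * n - 1`, a single power of `A`
survives. -/
lemma prod_shellSum (hT : T.DistinctColors) {Λ μ : ℝ} (hd : 2 ≤ d) (hΛ : 0 < Λ)
    (y : Fin n → ℝ) :
    ∏ b, (((Λ ^ (2 * eta d)) ^ T.coord b)⁻¹ *
        shellSum (Fin (d - T.coord b)) (2 * eta d) (T.coord b) Λ μ (y b)) =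
      Λ ^ (2 * eta d) * iota d ^ n / (2 * Λ) ^ (n - 1) *
        ∏ b, normShellSum (T.coord b) μ d Λ (y b) := by
  have hι := iota_pos hd
  set A := Λ ^ (2 * eta d) with hA
  have hA0 : 0 < A := by positivity
  have h1 : ∀ b, (A ^ T.coord b)⁻¹ *
        shellSum (Fin (d - T.coord b)) (2 * eta d) (T.coord b) Λ μ (y b) =
      (2 * iota d * (A ^ 2 * Λ) * ((2 * A * Λ)⁻¹) ^ T.coord b) *
        normShellSum (T.coord b) μ d Λ (y b) := by
    intro b
    obtain ⟨j, hj⟩ := Nat.exists_eq_add_of_le' (T.coord_pos b)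
    have hdim : Λ ^ (d - T.coord b) * Λ ^ T.coord b = A ^ 2 * Λ := by
      rw [← pow_add, Nat.sub_add_cancel (T.coord_le_dim hT b), rpow_natCast_dim hΛ]
    rw [← hdim, normShellSum, hj, add_tsub_cancel_right]
    generalize shellSum (Fin (d - (j + 1))) (2 * eta d) (j + 1) Λ μ (y b) = S
    rw [inv_pow, mul_pow, mul_pow, pow_succ 2 j]
    field_simp
  obtain ⟨j, hj⟩ := Nat.exists_eq_add_of_le' T.pos_of_root
  rw [Finset.prod_congr rfl fun b _ => h1 b, Finset.prod_mul_distrib, Finset.prod_mul_distrib,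
    Finset.prod_pow_eq_pow_sum, T.sum_coord, Finset.prod_const, Finset.card_univ,
    Fintype.card_fin]
  congr 1
  subst hj
  have e1 : 2 * (j + 1) - 1 = 2 * j + 1 := by omega
  rw [e1, add_tsub_cancel_right]
  simp only [inv_pow, mul_pow, pow_succ, pow_mul]
  field_simp
  ring

/-- The amplitude, divided by the volume of the edge momenta, as a sum over the edge momenta. -/
lemma amplitude_eq (hT : T.DistinctColors) {Λ m μ : ℝ} (hd : 2 ≤ d) (hΛ : 0 < Λ)
    (hm : 0 < m) (hμ : (m / Λ) ^ (2 * eta d) = μ) (p : ℤ) :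
    T.amplitude Λ m p = Λ ^ (2 * eta d) * iota d ^ n * (((2 * Λ) ^ (n - 1))⁻¹ *
      ∑ Q ∈ T.edgeMomenta p ⌈Λ⌉, ∏ b, normShellSum (T.coord b) μ d Λ (T.offset Λ Q b)) := by
  rw [T.amplitude_eq_sum hT hd hΛ hm hμ, Finset.sum_congr rfl fun Q _ =>
    T.prod_shellSum hT hd hΛ (T.offset Λ Q), ← Finset.mul_sum]
  ring

/-- Each vertex brings the sign `(-1) ^ (m(b) - 1)`; the exponents add up to `n - 1`, which cancels
the prefactor of `c_n`. -/
lemma coeff_eq {μ x : ℝ} (hμ : 0 < μ) (hx : 0 ≤ x) (hx1 : x < 1) :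
    (1 - x) * T.coeff μ x = ∏ b, loopIntegral μ (T.coord b) (T.external x b) := by
  have hsum : ∑ b, (T.coord b - 1) = n - 1 := by
    have h1 : ∑ b, (T.coord b - 1 + 1) = 2 * n - 1 := by
      rw [← T.sum_coord]
      exact Finset.sum_congr rfl fun b _ => Nat.sub_add_cancel (T.coord_pos b)
    rw [Finset.sum_add_distrib] at h1
    simp only [Finset.sum_const, Finset.card_univ, Fintype.card_fin, smul_eq_mul, mul_one] at h1
    omega
  have hb : ∀ b ∈ Finset.univ.erase T.root,
      iteratedDeriv (T.coord b) omega μ / ((T.coord b - 1).factorial : ℝ) =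
        (-1) ^ (T.coord b - 1) * loopIntegral μ (T.coord b) (T.external x b) := by
    intro b hb
    have : ((T.coord b - 1).factorial : ℝ) ≠ 0 := by positivity
    rw [iteratedDeriv_omega hμ (T.coord_pos b), external, if_neg (Finset.ne_of_mem_erase hb)]
    field_simp
  have hr : (1 - x) * rootFactor (T.coord T.root) μ x =
      (-1) ^ (T.coord T.root - 1) * loopIntegral μ (T.coord T.root) (T.external x T.root) := by
    have : 1 - x ≠ 0 := by linarith
    rw [rootFactor_eq hμ (T.coord_pos _) hx hx1, external, if_pos rfl]
    field_simp
  have hprod := Finset.prod_erase_mul Finset.univ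
    (fun b => (-1) ^ (T.coord b - 1) * loopIntegral μ (T.coord b) (T.external x b))
    (Finset.mem_univ T.root)
  rw [coeff, Finset.prod_congr rfl hb]
  calc _ = (-1) ^ (n - 1) * ((∏ b ∈ Finset.univ.erase T.root, (-1) ^ (T.coord b - 1) *
          loopIntegral μ (T.coord b) (T.external x b)) *
          ((1 - x) * rootFactor (T.coord T.root) μ x)) := by ring
    _ = _ := by
      rw [hr, hprod, Finset.prod_mul_distrib, Finset.prod_pow_eq_pow_sum, hsum, ← mul_assoc,
        ← mul_pow]
      norm_num

end TwoPointTree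

/-! ### Two-sided bounds on the sum over edge momenta -/

/-- The hypotheses on the dimension and the cutoff under which the amplitudes of all trees on `n`
loop vertices are close to their limits. -/
structure Regime (n : ℕ) (μ δ e σ : ℝ) (d : ℕ) (Λ : ℝ) : Prop where
  two_le : 2 ≤ d
  pos : 0 < Λ
  bounds : ∀ k, 1 ≤ k → k ≤ n → ∀ x, 0 ≤ x → x ≤ 1 - δ →
    normShellSum k μ d Λ x ≤ (1 + e) * loopIntegral μ k x ∧
      ∀ y ≤ x + n * σ, 0 ≤ y → (1 - e) * loopIntegral μ k x ≤ normShellSum k μ d Λ y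
  ceil_le : (2 * ⌈Λ⌉ + 1) / (2 * Λ) ≤ 1 + e
  le_floor : 1 - e ≤ (2 * ⌊σ ^ (1 / (2 * eta d)) * Λ⌋ + 1) / (2 * Λ)

/-- The order of choices matters: `σ` depends only on `n`, `μ`, `δ`, `e`, and is fixed before `d`
grows, so that `σ ^ (1 / (2η)) → 1`. -/
lemma exists_eventually_regime {μ δ e : ℝ} (n : ℕ) (hμ : 0 < μ) (hδ : 0 < δ) (he : 0 < e) :
    ∃ σ, 0 < σ ∧ σ ≤ 1 ∧ ∀ᶠ z : ℕ × ℝ in atTop.curry atTop, Regime n μ δ e σ z.1 z.2 := by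
  obtain ⟨τ, hτ, hτ0⟩ := ((eventually_normShellSum_bounds_uniform n hμ hδ he).and
    self_mem_nhdsWithin).exists
  have hτ0' : 0 < τ := hτ0
  obtain ⟨σ, hσ0, hσ1, hσn⟩ : ∃ σ : ℝ, 0 < σ ∧ σ ≤ 1 ∧ n * σ ≤ τ := by
    refine ⟨min 1 (τ / (n + 1)), by positivity, min_le_left _ _, ?_⟩
    calc n * min 1 (τ / (n + 1)) ≤ (n + 1) * (τ / (n + 1)) := by
          gcongr
          · linarith
          · exact min_le_right _ _
      _ = τ := by field_simp
  refine ⟨σ, hσ0, hσ1, ?_⟩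
  have hpow : Tendsto (fun d : ℕ => σ ^ (1 / (2 * eta d))) atTop (𝓝 1) := by
    have := (Real.continuousAt_const_rpow (b := 0) hσ0.ne').tendsto.comp
      tendsto_one_div_two_mul_eta
    rwa [Real.rpow_zero] at this
  filter_upwards [hτ, eventually_curry_fst (eventually_ge_atTop 2),
    eventually_curry_snd (eventually_gt_atTop 0),
    -- From `2 ≤ e * Λ` the rounding errors of the ceiling and the floor are absorbed into `e`.
    eventually_curry_snd (eventually_ge_atTop (2 / e)),
    eventually_curry_fst (hpow.eventually (lt_mem_nhds (show 1 - e / 2 < 1 by linarith)))]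
    with z hz hd hΛ hΛe hσe
  rw [div_le_iff₀ he] at hΛe
  refine ⟨hd, hΛ, fun k hk hkn x hx hx1 => ?_, ?_, ?_⟩
  · exact ⟨(hz k hk hkn x hx hx1).1, fun y hy hy0 =>
      (hz k hk hkn x hx hx1).2 y (by linarith) hy0⟩
  · rw [div_le_iff₀ (by positivity)]
    have := (Int.ceil_lt_add_one z.2).le
    nlinarith
  · rw [le_div_iff₀ (by positivity)]
    have := (Int.sub_one_lt_floor (σ ^ (1 / (2 * eta z.1)) * z.2)).le
    nlinarith [mul_le_mul_of_nonneg_right hσe.le hΛ.le]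

namespace Regime

variable {n d : ℕ} {μ δ e σ Λ m : ℝ} {p : ℤ}

lemma external_mem (h : Regime n μ δ e σ d Λ) (T : TwoPointTree n d)
    (hp : (|(p : ℝ)| / Λ) ^ (2 * eta d) ≤ 1 - δ) (b : Fin n) :
    0 ≤ T.external ((|(p : ℝ)| / Λ) ^ (2 * eta d)) b ∧
      T.external ((|(p : ℝ)| / Λ) ^ (2 * eta d)) b ≤ 1 - δ := by
  have h0 : 0 ≤ (|(p : ℝ)| / Λ) ^ (2 * eta d) :=
    Real.rpow_nonneg (div_nonneg (abs_nonneg _) h.pos.le) _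
  exact ⟨T.external_nonneg h0 b, T.external_le hp (h0.trans hp) b⟩

lemma loopIntegral_external_pos (h : Regime n μ δ e σ d Λ) (hμ : 0 < μ) (hδ : 0 < δ)
    (T : TwoPointTree n d) (hp : (|(p : ℝ)| / Λ) ^ (2 * eta d) ≤ 1 - δ) (k : ℕ) (b : Fin n) :
    0 < loopIntegral μ k (T.external ((|(p : ℝ)| / Λ) ^ (2 * eta d)) b) :=
  loopIntegral_pos hμ (h.external_mem T hp b).1 (by linarith [(h.external_mem T hp b).2])

/-- Edge momenta only increase the offsets, so each term is at most its value at zero edge momenta;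
the number of terms is `(2⌈Λ⌉ + 1) ^ (n - 1)`. -/
lemma sum_le (h : Regime n μ δ e σ d Λ) (hμ : 0 < μ) (hδ : 0 < δ) (he : 0 < e)
    (T : TwoPointTree n d) (hT : T.DistinctColors)
    (hp : (|(p : ℝ)| / Λ) ^ (2 * eta d) ≤ 1 - δ) :
    ((2 * Λ) ^ (n - 1))⁻¹ *
        ∑ Q ∈ T.edgeMomenta p ⌈Λ⌉, ∏ b, normShellSum (T.coord b) μ d Λ (T.offset Λ Q b) ≤
      (1 + e) ^ (n - 1) * (1 + e) ^ n *
        ∏ b, loopIntegral μ (T.coord b) (T.external ((|(p : ℝ)| / Λ) ^ (2 * eta d)) b) := by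
  have hΛ := h.pos
  have hpos := fun b => h.loopIntegral_external_pos hμ hδ T hp (T.coord b) b
  have hterm : ∀ Q ∈ T.edgeMomenta p ⌈Λ⌉, ∏ b, normShellSum (T.coord b) μ d Λ (T.offset Λ Q b) ≤
      (1 + e) ^ n *
        ∏ b, loopIntegral μ (T.coord b) (T.external ((|(p : ℝ)| / Λ) ^ (2 * eta d)) b) := by
    intro Q hQ
    have hoff := T.external_le_offset hT hΛ hQ
    calc _ ≤ ∏ b, ((1 + e) * loopIntegral μ (T.coord b)
          (T.external ((|(p : ℝ)| / Λ) ^ (2 * eta d)) b)) := by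
          refine Finset.prod_le_prod (fun b _ => normShellSum_nonneg h.two_le hΛ ?_)
            fun b _ => ?_
          · linarith [(h.external_mem T hp b).1, hoff b]
          · exact (normShellSum_anti h.two_le hΛ (by linarith [(h.external_mem T hp b).1])
              (hoff b)).trans (h.bounds _ (T.coord_pos b) (T.coord_le b) _
                (h.external_mem T hp b).1 (h.external_mem T hp b).2).1
      _ = _ := by
          rw [Finset.prod_mul_distrib, Finset.prod_const, Finset.card_univ, Fintype.card_fin]
  have hP : 0 < ∏ b, loopIntegral μ (T.coord b)
      (T.external ((|(p : ℝ)| / Λ) ^ (2 * eta d)) b) := Finset.prod_pos fun b _ => hpos b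
  refine (mul_le_mul_of_nonneg_left (Finset.sum_le_card_nsmul _ _ _ hterm)
    (by positivity)).trans ?_
  have hL : 0 ≤ ⌈Λ⌉ := Int.ceil_nonneg hΛ.le
  rw [nsmul_eq_mul, T.card_edgeMomenta hT p hL, ← mul_assoc, ← mul_assoc, ← inv_pow, ← mul_pow,
    inv_mul_eq_div]
  have hL' : (0 : ℝ) ≤ ⌈Λ⌉ := by exact_mod_cast hL
  gcongr
  exact h.ceil_le

/-- All terms are nonnegative, so only edge momenta up to `σ ^ (1 / (2η)) * Λ` are kept; there the
offsets exceed the external ones by at most `n * σ`. -/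
lemma le_sum (h : Regime n μ δ e σ d Λ) (hμ : 0 < μ) (hδ : 0 < δ) (he1 : e < 1)
    (hσ : 0 < σ) (hσ1 : σ ≤ 1) (T : TwoPointTree n d) (hT : T.DistinctColors)
    (hp : (|(p : ℝ)| / Λ) ^ (2 * eta d) ≤ 1 - δ) :
    (1 - e) ^ (n - 1) * (1 - e) ^ n *
        ∏ b, loopIntegral μ (T.coord b) (T.external ((|(p : ℝ)| / Λ) ^ (2 * eta d)) b) ≤
      ((2 * Λ) ^ (n - 1))⁻¹ *
        ∑ Q ∈ T.edgeMomenta p ⌈Λ⌉, ∏ b, normShellSum (T.coord b) μ d Λ (T.offset Λ Q b) := by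
  have hΛ := h.pos
  have hs := two_mul_eta_pos h.two_le
  have hpos := fun b => h.loopIntegral_external_pos hμ hδ T hp (T.coord b) b
  set R := ⌊σ ^ (1 / (2 * eta d)) * Λ⌋ with hR
  have hR0 : 0 ≤ R := Int.floor_nonneg.2 (by positivity)
  have hRL : R ≤ ⌈Λ⌉ := by
    refine (Int.floor_mono ?_).trans (Int.floor_le_ceil Λ)
    exact mul_le_of_le_one_left hΛ.le (Real.rpow_le_one hσ.le hσ1 (by positivity))
  have hterm : ∀ Q ∈ T.edgeMomenta p R, (1 - e) ^ n *
        ∏ b, loopIntegral μ (T.coord b) (T.external ((|(p : ℝ)| / Λ) ^ (2 * eta d)) b) ≤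
      ∏ b, normShellSum (T.coord b) μ d Λ (T.offset Λ Q b) := by
    intro Q hQ
    calc _ = ∏ b, ((1 - e) * loopIntegral μ (T.coord b)
          (T.external ((|(p : ℝ)| / Λ) ^ (2 * eta d)) b)) := by
          rw [Finset.prod_mul_distrib, Finset.prod_const, Finset.card_univ, Fintype.card_fin]
      _ ≤ _ := by
          refine Finset.prod_le_prod
            (fun b _ => mul_nonneg (by linarith) (hpos b).le) fun b _ => ?_
          exact (h.bounds _ (T.coord_pos b) (T.coord_le b) _ (h.external_mem T hp b).1
            (h.external_mem T hp b).2).2 _ (T.offset_le hT h.two_le hΛ hσ hQ b)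
            ((h.external_mem T hp b).1.trans (T.external_le_offset hT hΛ hQ b))
  have hP : 0 < ∏ b, loopIntegral μ (T.coord b)
      (T.external ((|(p : ℝ)| / Λ) ^ (2 * eta d)) b) := Finset.prod_pos fun b _ => hpos b
  have hsub : ∑ Q ∈ T.edgeMomenta p R, ∏ b, normShellSum (T.coord b) μ d Λ (T.offset Λ Q b) ≤
      ∑ Q ∈ T.edgeMomenta p ⌈Λ⌉, ∏ b, normShellSum (T.coord b) μ d Λ (T.offset Λ Q b) := by
    refine Finset.sum_le_sum_of_subset_of_nonneg (T.edgeMomenta_mono hRL) fun Q hQ _ =>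
      Finset.prod_nonneg fun b _ => normShellSum_nonneg h.two_le hΛ ?_
    linarith [(h.external_mem T hp b).1, T.external_le_offset hT hΛ hQ b]
  refine le_trans ?_ (mul_le_mul_of_nonneg_left
    ((Finset.card_nsmul_le_sum _ _ _ hterm).trans hsub) (by positivity))
  rw [nsmul_eq_mul, T.card_edgeMomenta hT p hR0, ← mul_assoc, ← mul_assoc, ← inv_pow, ← mul_pow,
    inv_mul_eq_div]
  have he' : 0 ≤ 1 - e := by linarith
  gcongr
  exact h.le_floor

end Regime

end TGFT

end

/-! ### Conclusion -/

theorem proposition2 (n : ℕ) (μ : ℝ) (hμ : 0 < μ) :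
    (TGFT.omega μ = ∫ x in (0 : ℝ)..μ, ∫ y in (0 : ℝ)..1, y / (y + x)) ∧
    ∀ δ : ℝ, 0 < δ → ∀ ε : ℝ, 0 < ε →
      ∃ D : ℕ, ∀ d : ℕ, D ≤ d →
        ∃ Λ₀ : ℝ, 0 < Λ₀ ∧ ∀ Λ : ℝ, Λ₀ ≤ Λ →
          ∀ m : ℝ, 0 < m → (m / Λ) ^ (2 * TGFT.eta d) = μ →
          ∀ T : TGFT.TwoPointTree n d, T.DistinctColors →
          ∀ p : ℤ, |(p : ℝ)| ^ (2 * TGFT.eta d) ≤ (1 - δ) * Λ ^ (2 * TGFT.eta d) →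
            |T.amplitude Λ m p -
                (Λ ^ (2 * TGFT.eta d) - |(p : ℝ)| ^ (2 * TGFT.eta d)) *
                  T.coeff μ (|(p : ℝ)| ^ (2 * TGFT.eta d) / Λ ^ (2 * TGFT.eta d)) *
                  TGFT.iota d ^ n| ≤
              ε * |(Λ ^ (2 * TGFT.eta d) - |(p : ℝ)| ^ (2 * TGFT.eta d)) *
                  T.coeff μ (|(p : ℝ)| ^ (2 * TGFT.eta d) / Λ ^ (2 * TGFT.eta d)) *
                  TGFT.iota d ^ n| := by
  refine ⟨TGFT.omega_eq_integral hμ, fun δ hδ ε hε => ?_⟩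
  -- A factor `1 ± e` is lost for each of the `n - 1` edge sums and each of the `n` vertices.
  obtain ⟨e, he0, he1, heu, hel⟩ : ∃ e : ℝ, 0 < e ∧ e < 1 ∧
      (1 + e) ^ (n - 1) * (1 + e) ^ n ≤ 1 + ε ∧ 1 - ε ≤ (1 - e) ^ (n - 1) * (1 - e) ^ n := by
    have hu : Filter.Tendsto (fun e : ℝ => (1 + e) ^ (n - 1) * (1 + e) ^ n)
        (nhdsWithin 0 (Set.Ioi 0)) (nhds 1) := by
      have hc : Continuous fun e : ℝ => (1 + e) ^ (n - 1) * (1 + e) ^ n := by fun_prop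
      simpa using (hc.tendsto 0).mono_left nhdsWithin_le_nhds
    have hl : Filter.Tendsto (fun e : ℝ => (1 - e) ^ (n - 1) * (1 - e) ^ n)
        (nhdsWithin 0 (Set.Ioi 0)) (nhds 1) := by
      have hc : Continuous fun e : ℝ => (1 - e) ^ (n - 1) * (1 - e) ^ n := by fun_prop
      simpa using (hc.tendsto 0).mono_left nhdsWithin_le_nhds
    have hI : ∀ᶠ e : ℝ in nhdsWithin 0 (Set.Ioi 0), e ∈ Set.Ioo 0 1 := Ioo_mem_nhdsGT one_pos
    obtain ⟨e, he, h1, h2⟩ := (hI.and ((hu.eventually (gt_mem_nhds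
      (by linarith : (1 : ℝ) < 1 + ε))).and
      (hl.eventually (lt_mem_nhds (by linarith : 1 - ε < (1 : ℝ)))))).exists
    exact ⟨e, he.1, he.2, h1.le, h2.le⟩
  obtain ⟨σ, hσ0, hσ1, hreg⟩ := TGFT.exists_eventually_regime n hμ hδ he0
  obtain ⟨D, hD⟩ := Filter.eventually_atTop.1 (Filter.eventually_curry_iff.1 hreg)
  refine ⟨D, fun d hd => ?_⟩
  obtain ⟨Λ₁, hΛ₁⟩ := Filter.eventually_atTop.1 (hD d hd)
  refine ⟨max 1 Λ₁, by positivity, fun Λ hΛ m hm hmμ T hT p hp => ?_⟩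
  have h : TGFT.Regime n μ δ e σ d Λ := hΛ₁ Λ ((le_max_right _ _).trans hΛ)
  have hΛ0 := h.pos
  have hA : 0 < Λ ^ (2 * TGFT.eta d) := by positivity
  have hι := TGFT.iota_pos h.two_le
  have hx : (|(p : ℝ)| / Λ) ^ (2 * TGFT.eta d) =
      |(p : ℝ)| ^ (2 * TGFT.eta d) / Λ ^ (2 * TGFT.eta d) :=
    Real.div_rpow (abs_nonneg _) hΛ0.le _
  have hx1 : (|(p : ℝ)| / Λ) ^ (2 * TGFT.eta d) ≤ 1 - δ := by
    rw [hx, div_le_iff₀ hA]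
    exact hp
  have hcoeff := T.coeff_eq hμ (by positivity : 0 ≤ (|(p : ℝ)| / Λ) ^ (2 * TGFT.eta d))
    (by linarith)
  have hsplit : Λ ^ (2 * TGFT.eta d) - |(p : ℝ)| ^ (2 * TGFT.eta d) =
      Λ ^ (2 * TGFT.eta d) * (1 - (|(p : ℝ)| / Λ) ^ (2 * TGFT.eta d)) := by
    rw [hx]
    field_simp
  have hP : 0 < ∏ b, TGFT.loopIntegral μ (T.coord b)
      (T.external ((|(p : ℝ)| / Λ) ^ (2 * TGFT.eta d)) b) :=
    Finset.prod_pos fun b _ => h.loopIntegral_external_pos hμ hδ T hx1 _ b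
  have hu := h.sum_le hμ hδ he0 T hT hx1
  have hl := h.le_sum hμ hδ he1 hσ0 hσ1 T hT hx1
  rw [← hx, hsplit, mul_assoc (Λ ^ (2 * TGFT.eta d)), hcoeff,
    T.amplitude_eq hT h.two_le hΛ0 hm hmμ]
  set P := ∏ b, TGFT.loopIntegral μ (T.coord b)
      (T.external ((|(p : ℝ)| / Λ) ^ (2 * TGFT.eta d)) b)
  set S := ((2 * Λ) ^ (n - 1))⁻¹ * ∑ Q ∈ T.edgeMomenta p ⌈Λ⌉,
    ∏ b, TGFT.normShellSum (T.coord b) μ d Λ (T.offset Λ Q b)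
  -- Amplitude and right-hand side share the positive factor `Λ ^ (2η) * ι(d) ^ n`, and `P > 0`, so
  -- this is already the relative estimate.
  have hS : |S - P| ≤ ε * P := by
    rw [abs_le]
    constructor
    · linarith [mul_le_mul_of_nonneg_right hel hP.le]
    · linarith [mul_le_mul_of_nonneg_right heu hP.le]
  have hAι : 0 < Λ ^ (2 * TGFT.eta d) * TGFT.iota d ^ n := by positivity
  have e1 : Λ ^ (2 * TGFT.eta d) * TGFT.iota d ^ n * S -
      Λ ^ (2 * TGFT.eta d) * P * TGFT.iota d ^ n =
      Λ ^ (2 * TGFT.eta d) * TGFT.iota d ^ n * (S - P) := by ring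
  have e2 : Λ ^ (2 * TGFT.eta d) * P * TGFT.iota d ^ n =
      Λ ^ (2 * TGFT.eta d) * TGFT.iota d ^ n * P := by ring
  rw [e1, e2, abs_mul _ (S - P), abs_mul _ P, abs_of_pos hAι, abs_of_pos hP, mul_left_comm]
  exact mul_le_mul_of_nonneg_left hS hAι.le
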